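/- **Definitions.** Let $s \geq 0$ be an integer. An $s$-step nilmanifold $X=G/\Gamma$ is the quotient of a connected, simply connected real Lie group $G$ with $G_{s+1}=\{1\}$ (where $G_1=G$, $G_{i+1}=[G,G_i]$) by a discrete cocompact subgroup $\Gamma$, endowed with a smooth Riemannian metric and the associated distance $d_{X}$. The power $X^k=G^k/\Gamma^k$ is endowed with the product Riemannian metric, i.e. with the distance $\big(\sum_{i} d_X(x_i,y_i)^2\big)^{1/2}$. For $X$ or a power $X^k$, write $H$ for the acting group ($G$ or $G^k$). A bounded nilsequence with Lipschitz constant at most $M$ is a sequence $n\mapsto F(g^nx)$ ($n \in \mathbb{N}$) with $g\in H$, $x$ a point of the nilmanifold, and $F$ a function on the nilmanifold with values in $[-1,1]$ and Lipschitz constant at most $M$. An averaged nilsequence with Lipschitz constant at most $M$ is a sequence $n\mapsto \mathbb{E}_{i\in I}F_i(g_i^nx_i)$, where $I$ is a finite non-empty set and each $n\mapsto F_i(g_i^nx_i)$ is a bounded nilsequence with Lipschitz constant at most $M$. For $N\ge 1$ let $[N]=\{1,\dots,N\}$; for $f:[N]\to\mathbb{C}$ let $$\|f\|_{U^{s+1}[N]}^{2^{s+1}}=\mathbb{E}_{x\in\mathbb{Z},\,h\in\mathbb{Z}^{s+1}:\;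 x+\omega\cdot h\in[N]\ \forall \omega\in\{0,1\}^{s+1}}\ \prod_{\omega\in\{0,1\}^{s+1}}\mathcal{C}^{|\omega|}f(x+\omega\cdot h),$$ where $\mathcal{C}$ is complex conjugation and $|\omega|=\omega_1+\dots+\omega_{s+1}$; and let $$\|F\|_{U^{s+1}[N]^*}=\sup\{|\mathbb{E}_{n\in[N]}f(n)F(n)| : \|f\|_{U^{s+1}[N]}\le 1\}.$$ **Proposition (Decomposition of nilsequences).** Let $G/\Gamma$ be an $s$-step nilmanifold, let $M>0$ and $\varepsilon\in(0,1)$. There are constants $L,D>0$, depending only on $s$, $M$, $\varepsilon$ and $G/\Gamma$ (with its metric), such that the following holds. Let $F:G/\Gamma\to[-1,1]$ have Lipschitz constant at most $M$, let $g\in G$, $x\in G/\Gamma$ and let $N\ge1$ be an integer. Then there are $F_1:\mathbb{N}\to[-1,1]$ and $F_2:\mathbb{N}\to\mathbb{R}$ with $$F(g^nx)=F_1(n)+F_2(n)\qquad\text{for all } n\in\mathbb{N},$$ such that $F_1$ is an averaged nilsequence on $(G/\Gamma)^{2^{s+1}-1}$ with Lipschitz constant at most $L$, $\|F_1\|_{U^{s+1}[N]^*}\le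 D$, and $\|F_2\|_\infty=\sup_{n}|F_2(n)|\le\varepsilon$. -/

import Mathlib

open scoped Manifold ContDiff ENNReal Bundle

/-! ### Local Gowers norms on `[N]` and their dual norms -/

/-- The vertex `x + v₁ h₁ + ⋯ + v_k h_k` of the `k`-dimensional parallelepiped in `ℤ` with base
point `x` and edges `h`; here `v ∈ {0,1}^k` is encoded as a function `Fin k → Bool`. -/
def gowersVertex {k : ℕ} (x : ℤ) (h : Fin k → ℤ) (v : Fin k → Bool) : ℤ :=
  x + ∑ j, if v j then h j else 0

/-- The finite set of all `(x, h) ∈ ℤ × ℤ^k` such that all the vertices `x + v · h`,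
`v ∈ {0,1}^k`, lie in `[N] = {1, …, N}`.  (The restriction of the edges to `[-N, N]` is
automatic, see `mem_gowersCubes`; it is only there to have a finite set.) -/
noncomputable def gowersCubes (k N : ℕ) : Finset (ℤ × (Fin k → ℤ)) :=
  (Finset.Icc (1 : ℤ) N ×ˢ Fintype.piFinset fun _ : Fin k => Finset.Icc (-(N : ℤ)) N).filter
    fun p => ∀ v : Fin k → Bool, gowersVertex p.1 p.2 v ∈ Finset.Icc (1 : ℤ) N

theorem mem_gowersCubes {k N : ℕ} (p : ℤ × (Fin k → ℤ)) :
    p ∈ gowersCubes k N ↔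
      ∀ v : Fin k → Bool, gowersVertex p.1 p.2 v ∈ Finset.Icc (1 : ℤ) N := by
  constructor
  · intro hp
    exact (Finset.mem_filter.1 hp).2
  · intro hp
    have h0 := hp fun _ => false
    simp only [gowersVertex, Bool.false_eq_true, if_false, Finset.sum_const_zero,
      add_zero] at h0
    refine Finset.mem_filter.2 ⟨Finset.mem_product.2 ⟨h0, Fintype.mem_piFinset.2 fun j => ?_⟩, hp⟩
    have hj := hp fun i => decide (i = j)
    simp only [gowersVertex, decide_eq_true_eq, Finset.sum_ite_eq', Finset.mem_univ,
      if_true] at hj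
    rw [Finset.mem_Icc] at h0 hj ⊢
    omega

/-- `𝒞^{|v|} z`: the complex conjugation applied `|v|` times, `|v|` being the number of `1`s
in `v ∈ {0,1}^k`. -/
noncomputable def conjPow {k : ℕ} (v : Fin k → Bool) (z : ℂ) : ℂ :=
  (starRingEnd ℂ)^[(Finset.univ.filter fun j => v j = true).card] z

/-- The Gowers norm `‖f‖_{U^k[N]}`, given by
`‖f‖_{U^k[N]}^{2^k} = 𝔼_{x, h : x + v · h ∈ [N] ∀ v} ∏_v 𝒞^{|v|} f(x + v · h)`.
Only the values of `f` on `[N]` matter.  The average is a nonnegative real number, so taking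
its modulus does not change it. -/
noncomputable def gowersNorm (k N : ℕ) (f : ℤ → ℂ) : ℝ :=
  ‖(∑ p ∈ gowersCubes k N, ∏ v : Fin k → Bool, conjPow v (f (gowersVertex p.1 p.2 v))) /
      ((gowersCubes k N).card : ℂ)‖ ^ ((1 : ℝ) / 2 ^ k)

/-- The dual norm `‖F‖_{U^k[N]^*} = sup {|𝔼_{n ∈ [N]} f(n) F(n)| : ‖f‖_{U^k[N]} ≤ 1}`, as an
extended nonnegative real number. -/
noncomputable def gowersDualNorm (k N : ℕ) (F : ℕ → ℝ) : ℝ≥0∞ :=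
  ⨆ (f : ℤ → ℂ) (_ : gowersNorm k N f ≤ 1),
    ‖(∑ n ∈ Finset.Icc 1 N, f (n : ℤ) * (F n : ℂ)) / (N : ℂ)‖ₑ

/-! ### Lipschitz functions and averaged nilsequences -/

/-- `F : X → ℝ` is continuous, takes values in `[-1, 1]`, and has Lipschitz constant at most `M`
with respect to the distance function `d` on `X`. -/
structure IsBoundedLipschitz {X : Type*} [TopologicalSpace X] (d : X → X → ℝ≥0∞) (M : ℝ)
    (F : X → ℝ) : Prop where
  continuous : Continuous F
  mem_Icc : ∀ x, F x ∈ Set.Icc (-1 : ℝ) 1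
  lipschitz : ∀ x y, ENNReal.ofReal |F x - F y| ≤ ENNReal.ofReal M * d x y

/-- `φ` is an averaged nilsequence with Lipschitz constant at most `M` on the nilmanifold `X`, with
acting group `G` and distance `d`: an average over a finite nonempty index set of bounded
nilsequences `n ↦ Fᵢ(gᵢⁿ xᵢ)` on `X` with Lipschitz constant at most `M`. -/
def IsAveragedNilsequence (G : Type*) {X : Type*} [Group G] [MulAction G X] [TopologicalSpace X]
    (d : X → X → ℝ≥0∞) (M : ℝ) (φ : ℕ → ℝ) : Prop :=
  ∃ (m : ℕ) (_ : 0 < m) (F : Fin m → X → ℝ) (g : Fin m → G) (x : Fin m → X),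
    (∀ i, IsBoundedLipschitz d M (F i)) ∧
      ∀ n : ℕ, φ n = (∑ i, F i (g i ^ n • x i)) / m

/-- The distance `(∑ᵢ d(xᵢ, yᵢ)²)^{1/2}` on `X^k`.  If `d` is the distance of a Riemannian metric
on `X`, this is the distance of the product Riemannian metric on `X^k`. -/
noncomputable def productEDist {X : Type*} (k : ℕ) (d : X → X → ℝ≥0∞) (x y : Fin k → X) : ℝ≥0∞ :=
  (∑ i, d (x i) (y i) ^ 2) ^ ((1 : ℝ) / 2)

/-! On an `s`-step nilmanifold the orbit parallelepipeds of dimension `s + 1` lie in a compact set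
of cubes in which the last vertex is determined by the other `2 ^ (s + 1) - 1` ones
(`exists_isCompact_cubes`). So `F` at the last vertex is a continuous function of the other
vertices, and Tietze and Stone–Weierstrass approximate it by a combination `Ψ` of products of
one-vertex Lipschitz functions (`exists_approx_of_isCompact_cubes`). With `n` as last vertex, `F₁ n`
is the average of `Ψ` over edges `u + u'`, where `u` and `u'` range over a box of side `N`; for
fixed edges the remaining vertices follow an orbit on the power of the nilmanifold. By Arzelà–Ascoli
finitely many `Ψ` serve all `F`, so the constants are uniform.

For the dual norm, pairing `f` with such an average of products is a Gowers form on `ZMod q`, with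
`q` a constant multiple of `N`, whose edges are weighted by the convolution of two box indicators.
Expanding the weight in characters costs little because it is a convolution square
(`norm_sum_add_le_of_fourier`). Each character of the edges splits into characters at the vertices,
and the Gowers–Cauchy–Schwarz inequality (`norm_gowersForm_pow_le`) applies, since the `U^{s+1}`
norm ignores linear characters when `s ≥ 1`. For `s = 0` the nilmanifold is a point.

Compactness of the cubes rests on the cocompactness of the lower central series of `Γ` in that of
`G` (`exists_compact_lcs_subset`). It uses only that elements near the identity have iterated square
roots `r n` tending to `1`: modulo deeper terms `⁅y, x⁆ = ⁅y ^ 2 ^ n, r n⁆`, and the compact part of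
`y ^ 2 ^ n` contributes nothing in the limit. Cocompactness then passes to the Host–Kra cube groups.
-/

/-! ### Gowers forms and the Gowers–Cauchy–Schwarz inequality on a finite abelian group. -/

section GowersForm

variable {Z : Type*} [AddCommGroup Z] [Fintype Z]

/-- The unnormalised multilinear Gowers form of a family of functions on a finite abelian group. -/
noncomputable def gowersForm (k : ℕ) (b : (Fin k → Bool) → Z → ℂ) : ℂ :=
  ∑ n : Z, ∑ h : Fin k → Z, ∏ v : Fin k → Bool, b v (n + ∑ j, if v j then h j else 0)

/-- The multiplicative derivative `n ↦ f n * conj (f (n + l))`. -/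
noncomputable def mulDeriv (l : Z) (f : Z → ℂ) (n : Z) : ℂ := f n * starRingEnd ℂ (f (n + l))

/-- The `2 ^ (k + 1)`-th power of the unnormalised `U^{k+1}` seminorm, defined recursively. -/
noncomputable def gowersPower : ℕ → (Z → ℂ) → ℝ
  | 0, f => ‖∑ n, f n‖ ^ 2
  | k + 1, f => ∑ l, gowersPower k (mulDeriv l f)

theorem gowersPower_nonneg (k : ℕ) (f : Z → ℂ) : 0 ≤ gowersPower k f := by
  induction k generalizing f with
  | zero => exact sq_nonneg _
  | succ k ih => exact Finset.sum_nonneg fun l _ => ih _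

theorem prod_cube_succ {k : ℕ} {M : Type*} [CommMonoid M] (a : (Fin (k + 1) → Bool) → M) :
    ∏ v, a v = (∏ v : Fin k → Bool, a (Fin.cons false v)) * ∏ v : Fin k → Bool, a (Fin.cons true v) := by
  rw [← (Fin.consEquiv fun _ : Fin (k + 1) => Bool).prod_comp, Fintype.prod_prod_type]
  simp [Fin.consEquiv, mul_comm]

theorem sum_pi_succ {k : ℕ} {W M : Type*} [Fintype W] [AddCommMonoid M] (a : (Fin (k + 1) → W) → M) :
    ∑ h, a h = ∑ l : W, ∑ h : Fin k → W, a (Fin.cons l h) := by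
  rw [← (Fin.consEquiv fun _ : Fin (k + 1) => W).sum_comp, Fintype.sum_prod_type]
  simp [Fin.consEquiv]

theorem gowersForm_zero (b : (Fin 0 → Bool) → Z → ℂ) :
    gowersForm 0 b = ∑ n, b (fun _ => false) n := by
  simp only [gowersForm, Fintype.sum_unique, Fintype.prod_unique, Finset.univ_eq_empty,
    Finset.sum_empty, add_zero]
  exact Finset.sum_congr rfl fun n _ => congr_arg (b · n) (Subsingleton.elim _ _)

theorem gowersForm_succ (k : ℕ) (b : (Fin (k + 1) → Bool) → Z → ℂ) :
    gowersForm (k + 1) b = ∑ l, ∑ n, ∑ h : Fin k → Z,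
      (∏ v, b (Fin.cons false v) (n + ∑ j, if v j then h j else 0)) *
        ∏ v, b (Fin.cons true v) (n + l + ∑ j, if v j then h j else 0) := by
  simp only [gowersForm, sum_pi_succ, prod_cube_succ, Fin.sum_univ_succ, Fin.cons_zero,
    Fin.cons_succ]
  rw [Finset.sum_comm]
  simp [add_assoc]

theorem norm_sq_sum_eq (f : Z → ℂ) :
    ((‖∑ n, f n‖ ^ 2 : ℝ) : ℂ) = ∑ l, ∑ n, mulDeriv l f n := by
  have h : ((‖∑ n, f n‖ ^ 2 : ℝ) : ℂ) = (∑ n, f n) * starRingEnd ℂ (∑ n, f n) := by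
    rw [Complex.mul_conj, Complex.normSq_eq_norm_sq]
  rw [h, Finset.sum_comm, Finset.sum_mul]
  refine Finset.sum_congr rfl fun n _ => ?_
  rw [map_sum, Finset.mul_sum]
  exact (Equiv.sum_comp (Equiv.addLeft n) fun m => f n * starRingEnd ℂ (f m)).symm

theorem gowersForm_succ_eq_sum_mul (k : ℕ) (b : (Fin (k + 1) → Bool) → Z → ℂ) :
    gowersForm (k + 1) b = ∑ h : Fin k → Z,
      (∑ n, ∏ v, b (Fin.cons false v) (n + ∑ j, if v j then h j else 0)) *
        ∑ n, ∏ v, b (Fin.cons true v) (n + ∑ j, if v j then h j else 0) := by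
  rw [gowersForm_succ, Finset.sum_comm]
  simp only [Finset.sum_comm (s := (Finset.univ : Finset Z)) (t := (Finset.univ : Finset (Fin k → Z)))]
  refine Finset.sum_congr rfl fun h _ => ?_
  rw [Finset.sum_mul_sum]
  refine Finset.sum_congr rfl fun n _ => ?_
  exact Equiv.sum_comp (Equiv.addLeft n) fun m =>
    (∏ v, b (Fin.cons false v) (n + ∑ j, if v j then h j else 0)) *
      ∏ v, b (Fin.cons true v) (m + ∑ j, if v j then h j else 0)

/-- For fixed `h` the form factors into a sum over each of two opposite faces. Cauchy–Schwarz in `h`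
discards the bounded face and squares the other one, and the square opens into multiplicative
derivatives. -/
theorem norm_gowersForm_succ_sq_le (k : ℕ) (b : (Fin (k + 1) → Bool) → Z → ℂ)
    (hb : ∀ v z, ‖b (Fin.cons true v) z‖ ≤ 1) :
    ‖gowersForm (k + 1) b‖ ^ 2 ≤ (Fintype.card Z : ℝ) ^ (k + 2) *
      ‖∑ l, gowersForm k fun v => mulDeriv l (b (Fin.cons false v))‖ := by
  set α : (Fin k → Z) → ℂ :=
    fun h => ∑ n, ∏ v, b (Fin.cons false v) (n + ∑ j, if v j then h j else 0) with hα
  set β : (Fin k → Z) → ℂ :=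
    fun h => ∑ n, ∏ v, b (Fin.cons true v) (n + ∑ j, if v j then h j else 0) with hβ
  have hβ1 (h) : ‖β h‖ ≤ Fintype.card Z := by
    refine (norm_sum_le _ _).trans ((Finset.sum_le_card_nsmul _ _ 1 fun n _ => ?_).trans (by simp))
    rw [norm_prod]
    exact Finset.prod_le_one (fun _ _ => norm_nonneg _) fun v _ => hb v _
  have key : ((∑ h, ‖α h‖ ^ 2 : ℝ) : ℂ) =
      ∑ l, gowersForm k fun v => mulDeriv l (b (Fin.cons false v)) := by
    rw [Complex.ofReal_sum]
    simp only [hα, norm_sq_sum_eq, gowersForm]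
    rw [Finset.sum_comm]
    refine Finset.sum_congr rfl fun l _ => ?_
    rw [Finset.sum_comm]
    refine Finset.sum_congr rfl fun n _ => Finset.sum_congr rfl fun h _ => ?_
    simp only [mulDeriv, map_prod, ← Finset.prod_mul_distrib]
    refine Finset.prod_congr rfl fun v _ => ?_
    rw [add_right_comm]
  rw [← key, Complex.norm_real, Real.norm_of_nonneg (Finset.sum_nonneg fun _ _ => sq_nonneg _),
    gowersForm_succ_eq_sum_mul]
  calc ‖∑ h, α h * β h‖ ^ 2 ≤ (∑ h, ‖α h‖ * ‖β h‖) ^ 2 := by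
        gcongr
        exact (norm_sum_le _ _).trans_eq (by simp)
    _ ≤ (∑ h, ‖α h‖ ^ 2) * ∑ h, ‖β h‖ ^ 2 := Finset.sum_mul_sq_le_sq_mul_sq _ _ _
    _ ≤ (∑ h, ‖α h‖ ^ 2) * ∑ _h : Fin k → Z, (Fintype.card Z : ℝ) ^ 2 := by
        gcongr with h
        exact hβ1 h
    _ = _ := by simp; ring

/-- The Gowers–Cauchy–Schwarz inequality in which all functions but one are bounded by `1`. -/
theorem norm_gowersForm_pow_le (k : ℕ) (b : (Fin (k + 1) → Bool) → Z → ℂ)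
    (hb : ∀ v, v ≠ (fun _ => false) → ∀ z, ‖b v z‖ ≤ 1) :
    ‖gowersForm (k + 1) b‖ ^ 2 ^ (k + 1) ≤
      (Fintype.card Z : ℝ) ^ ((k + 2) * (2 ^ (k + 1) - 1)) * gowersPower k (b fun _ => false) := by
  have hcons (k : ℕ) : (Fin.cons false (fun _ => false) : Fin (k + 1) → Bool) = fun _ => false := by
    ext j; refine Fin.cases ?_ (fun _ => ?_) j <;> simp
  have hnt (k : ℕ) (v : Fin k → Bool) : (Fin.cons true v : Fin (k + 1) → Bool) ≠ fun _ => false :=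
    fun h => by simpa using congr_fun h 0
  induction k with
  | zero =>
    have := norm_gowersForm_succ_sq_le 0 b fun v z => hb _ (hnt _ _) z
    simp only [gowersForm_zero, gowersPower] at this ⊢
    rw [← norm_sq_sum_eq, Complex.norm_real, Real.norm_of_nonneg (sq_nonneg _)] at this
    rw [hcons] at this
    simpa using this
  | succ k ih =>
    have h1 := norm_gowersForm_succ_sq_le (k + 1) b fun v z => hb _ (hnt _ _) z
    have h2 (l : Z) := ih (fun v => mulDeriv l (b (Fin.cons false v))) fun v hv z => by
      have hv' : (Fin.cons false v : Fin (k + 1 + 1) → Bool) ≠ fun _ => false := by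
        rw [← hcons]
        exact fun h => hv (Fin.cons_right_injective _ h)
      simp only [mulDeriv, norm_mul, RCLike.norm_conj]
      exact mul_le_one₀ (hb _ hv' _) (norm_nonneg _) (hb _ hv' _)
    simp only [hcons] at h2
    set q := (Fintype.card Z : ℝ)
    have hq : 0 ≤ q := Nat.cast_nonneg _
    obtain ⟨m, hm⟩ : ∃ m, 2 ^ (k + 1) = m + 1 := ⟨2 ^ (k + 1) - 1, by
      have := Nat.one_le_two_pow (n := k + 1); omega⟩
    -- Power mean inequality, which brings the exponent `2 ^ (k + 1)` inside the sum over `l` so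
    -- that the induction hypothesis applies to each term.
    have h3 : (∑ l, ‖gowersForm (k + 1) fun v => mulDeriv l (b (Fin.cons false v))‖) ^ (m + 1) ≤
        q ^ m * ∑ l, ‖gowersForm (k + 1) fun v => mulDeriv l (b (Fin.cons false v))‖ ^ (m + 1) := by
      have h := pow_sum_div_card_le_sum_pow (s := (Finset.univ : Finset Z))
        (f := fun l => ‖gowersForm (k + 1) fun v => mulDeriv l (b (Fin.cons false v))‖) 
        (fun _ _ => norm_nonneg _) m
      have hq' : 0 < q := by
        have : Nonempty Z := ⟨0⟩
        exact Nat.cast_pos.2 Fintype.card_pos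
      rw [div_le_iff₀ (by simpa using pow_pos hq' m)] at h
      rw [mul_comm]
      simpa using h
    calc ‖gowersForm (k + 1 + 1) b‖ ^ 2 ^ (k + 1 + 1)
        = (‖gowersForm (k + 1 + 1) b‖ ^ 2) ^ (m + 1) := by rw [← hm, ← pow_mul, pow_succ' 2]
      _ ≤ (q ^ (k + 3) * ∑ l, ‖gowersForm (k + 1) fun v => mulDeriv l (b (Fin.cons false v))‖)
            ^ (m + 1) := by
          gcongr
          exact h1.trans (by gcongr; exact norm_sum_le _ _)
      _ ≤ (q ^ (k + 3)) ^ (m + 1) * (q ^ m * ∑ l, q ^ ((k + 2) * m) *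
            gowersPower k (mulDeriv l (b fun _ => false))) := by
          rw [mul_pow]
          gcongr
          refine h3.trans ?_
          gcongr with l
          have := h2 l
          rwa [hm, Nat.add_sub_cancel] at this
      _ = _ := by
          rw [← Finset.mul_sum, gowersPower, pow_succ 2 (k + 1), hm,
            show (m + 1) * 2 - 1 = 2 * m + 1 by omega]
          ring

theorem conjPow_mul {k : ℕ} (v : Fin k → Bool) (z w : ℂ) :
    conjPow v (z * w) = conjPow v z * conjPow v w :=
  iterate_map_mul _ _ _ _

theorem conjPow_cons_false {k : ℕ} (v : Fin k → Bool) (z : ℂ) :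
    conjPow (Fin.cons false v : Fin (k + 1) → Bool) z = conjPow v z := by
  simp [conjPow, Fin.card_filter_univ_succ]

theorem conjPow_cons_true {k : ℕ} (v : Fin k → Bool) (z : ℂ) :
    conjPow (Fin.cons true v : Fin (k + 1) → Bool) z = conjPow v (starRingEnd ℂ z) := by
  simp [conjPow, Fin.card_filter_univ_succ]

theorem gowersForm_conjPow_succ (k : ℕ) (f : Z → ℂ) :
    gowersForm (k + 1) (fun v z => conjPow v (f z)) =
      ∑ l, gowersForm k fun v z => conjPow v (mulDeriv l f z) := by
  rw [gowersForm_succ]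
  simp only [gowersForm, mulDeriv, conjPow_mul, Finset.prod_mul_distrib, conjPow_cons_false,
    conjPow_cons_true, add_right_comm]

theorem gowersForm_conjPow (k : ℕ) (f : Z → ℂ) :
    gowersForm (k + 1) (fun v z => conjPow v (f z)) = gowersPower k f := by
  induction k generalizing f with
  | zero =>
    rw [gowersForm_conjPow_succ, gowersPower, norm_sq_sum_eq]
    simp [gowersForm_zero, conjPow]
  | succ k ih =>
    rw [gowersForm_conjPow_succ, gowersPower, Complex.ofReal_sum]
    exact Finset.sum_congr rfl fun l _ => ih _

theorem gowersPower_const_mul (k : ℕ) (c : ℂ) (hc : ‖c‖ = 1) (f : Z → ℂ) :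
    gowersPower k (fun n => c * f n) = gowersPower k f := by
  cases k with
  | zero => simp [gowersPower, ← Finset.mul_sum, hc]
  | succ k =>
    have (l : Z) : mulDeriv l (fun n => c * f n) = mulDeriv l f := by
      ext n
      have : c * starRingEnd ℂ c = 1 := by
        rw [Complex.mul_conj, Complex.normSq_eq_norm_sq, hc]; simp
      simp only [mulDeriv, map_mul]
      linear_combination (f n * starRingEnd ℂ (f (n + l))) * this
    simp only [gowersPower, this]

/-- A multiplicative derivative turns a character into a unimodular constant. At least one
derivative is needed, hence the index `k + 1`: the `U^1` seminorm is not invariant. -/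
theorem gowersPower_addChar_mul (k : ℕ) (ψ : AddChar Z ℂ) (f : Z → ℂ) :
    gowersPower (k + 1) (fun n => ψ n * f n) = gowersPower (k + 1) f := by
  simp only [gowersPower]
  refine Finset.sum_congr rfl fun l _ => ?_
  have : mulDeriv l (fun n => ψ n * f n) =
      fun n => starRingEnd ℂ (ψ l) * mulDeriv l f n := by
    ext n
    have h : ψ n * starRingEnd ℂ (ψ n) = 1 := by
      rw [Complex.mul_conj, Complex.normSq_eq_norm_sq, AddChar.norm_apply]; simp
    simp only [mulDeriv, map_mul, AddChar.map_add_eq_mul]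
    linear_combination (f n * starRingEnd ℂ (f (n + l)) * starRingEnd ℂ (ψ l)) * h
  rw [this, gowersPower_const_mul _ _ (by simp [AddChar.norm_apply])]

end GowersForm

/-! ### Fourier expansion of the edges and transfer from `[N]` to `ZMod q`. -/

/-- A sum over a sumset is controlled by the Fourier transform. -/
theorem norm_sum_add_le_of_fourier {A : Type*} [AddCommGroup A] [Fintype A] (T : A → ℂ) (B : ℝ)
    (hB : ∀ ψ : AddChar A ℂ, ‖∑ a, T a * ψ a‖ ≤ B) {ι : Type*} (I : Finset ι) (e : ι → A)
    (he : Set.InjOn e I) :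
    ‖∑ u ∈ I, ∑ v ∈ I, T (e u + e v)‖ ≤ I.card * B := by
  classical
  set q := (Fintype.card A : ℝ)
  have hq : 0 < q := Nat.cast_pos.2 Fintype.card_pos
  set c : AddChar A ℂ → ℂ := fun ψ => ∑ u ∈ I, ψ (-e u)
  have h1 (a : A) : (q : ℂ) * T a = ∑ ψ : AddChar A ℂ, (∑ b, T b * ψ b) * ψ (-a) := by
    simp only [Finset.sum_mul]
    rw [Finset.sum_comm]
    have (b : A) : ∑ ψ : AddChar A ℂ, T b * ψ b * ψ (-a) = if b = a then T b * q else 0 := by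
      simp only [mul_assoc, ← AddChar.map_add_eq_mul, ← Finset.mul_sum,
        AddChar.sum_apply_eq_ite, add_neg_eq_zero]
      split_ifs <;> simp [q]
    rw [Finset.sum_congr rfl fun b _ => this b]
    simp [mul_comm]
  -- The sumset weight has Fourier coefficients `c ψ * c ψ`, so their absolute values are summed
  -- exactly by Parseval in `h3`; a single box would not give this.
  have h2 : (q : ℂ) * ∑ u ∈ I, ∑ v ∈ I, T (e u + e v) =
      ∑ ψ : AddChar A ℂ, (∑ b, T b * ψ b) * (c ψ * c ψ) := by
    have (ψ : AddChar A ℂ) : (∑ b, T b * ψ b) * (c ψ * c ψ) =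
        ∑ u ∈ I, ∑ v ∈ I, (∑ b, T b * ψ b) * ψ (-(e u + e v)) := by
      generalize ∑ b, T b * ψ b = x
      simp only [c, Finset.sum_mul_sum, neg_add, AddChar.map_add_eq_mul]
      simp only [Finset.mul_sum]
    rw [Finset.sum_congr rfl fun ψ _ => this ψ, Finset.mul_sum,
      Finset.sum_comm (s := (Finset.univ : Finset (AddChar A ℂ)))]
    refine Finset.sum_congr rfl fun u _ => ?_
    rw [Finset.mul_sum, Finset.sum_comm (s := (Finset.univ : Finset (AddChar A ℂ)))]
    exact Finset.sum_congr rfl fun v _ => h1 (e u + e v)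
  have h3 : ∑ ψ : AddChar A ℂ, ‖c ψ‖ ^ 2 = q * I.card := by
    have : ((∑ ψ : AddChar A ℂ, ‖c ψ‖ ^ 2 : ℝ) : ℂ) = ((q * I.card : ℝ) : ℂ) := by
      have hc (ψ : AddChar A ℂ) : ((‖c ψ‖ ^ 2 : ℝ) : ℂ) = ∑ u ∈ I, ∑ v ∈ I, ψ (e v - e u) := by
        have : ((‖c ψ‖ ^ 2 : ℝ) : ℂ) = c ψ * starRingEnd ℂ (c ψ) := by
          rw [Complex.mul_conj, Complex.normSq_eq_norm_sq]
        rw [this, map_sum, Finset.sum_mul_sum]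
        refine Finset.sum_congr rfl fun u _ => Finset.sum_congr rfl fun v _ => ?_
        rw [AddChar.map_neg_eq_conj ψ (e v), Complex.conj_conj, ← AddChar.map_add_eq_mul,
          sub_eq_neg_add]
      rw [Complex.ofReal_sum]
      simp only [hc]
      rw [Finset.sum_comm]
      have (u) (hu : u ∈ I) : ∑ ψ : AddChar A ℂ, ∑ v ∈ I, ψ (e v - e u) = q := by
        rw [Finset.sum_comm, Finset.sum_eq_single_of_mem u hu]
        · simp [q]
        · intro v hv hvu
          rw [AddChar.sum_apply_eq_ite, if_neg]
          exact fun h => hvu (he hv hu (sub_eq_zero.1 h))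
      rw [Finset.sum_congr rfl this]
      simp [mul_comm]
    exact_mod_cast this
  have h4 : q * ‖∑ u ∈ I, ∑ v ∈ I, T (e u + e v)‖ ≤ q * (I.card * B) := by
    calc q * ‖∑ u ∈ I, ∑ v ∈ I, T (e u + e v)‖
        = ‖(q : ℂ) * ∑ u ∈ I, ∑ v ∈ I, T (e u + e v)‖ := by
          rw [norm_mul, Complex.norm_real, Real.norm_of_nonneg hq.le]
      _ ≤ ∑ ψ : AddChar A ℂ, B * ‖c ψ‖ ^ 2 := by
          rw [h2]
          refine (norm_sum_le _ _).trans (Finset.sum_le_sum fun ψ _ => ?_)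
          rw [norm_mul, norm_mul, ← sq]
          gcongr
          exact hB ψ
      _ = q * (I.card * B) := by rw [← Finset.mul_sum, h3]; ring
  exact le_of_mul_le_mul_left h4 hq

/-- The extension by zero to `ZMod q` of the restriction of `f` to `[N]`. -/
noncomputable def zmodExtend (q N : ℕ) (f : ℤ → ℂ) (z : ZMod q) : ℂ :=
  if z.val ∈ Finset.Icc 1 N then f z.val else 0

theorem sum_zmod_eq_sum_Icc {M : Type*} [AddCommMonoid M] {q N : ℕ} [NeZero q] (hq : N < q)
    (G : ℕ → M) :
    ∑ z : ZMod q, (if z.val ∈ Finset.Icc 1 N then G z.val else 0) = ∑ n ∈ Finset.Icc 1 N, G n := by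
  rw [← Finset.sum_filter]
  have hval (n) (hn : n ∈ Finset.Icc 1 N) : ((n : ℕ) : ZMod q).val = n :=
    ZMod.val_cast_of_lt (by rw [Finset.mem_Icc] at hn; omega)
  refine Finset.sum_nbij' (fun z => z.val) (fun n => (n : ZMod q)) ?_ ?_ ?_ hval ?_
  · simp
  · intro n hn
    simpa [hval n hn] using hn
  · simp
  · simp

theorem abs_gowersVertex_le {k N : ℕ} (x : ℤ) (h : Fin k → ℤ) (v : Fin k → Bool)
    (hx : |x| ≤ N) (hh : ∀ j, |h j| ≤ N) : |gowersVertex x h v| ≤ (k + 1) * N := by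
  have : |∑ j, if v j then h j else 0| ≤ ∑ _j : Fin k, (N : ℤ) := by
    refine (Finset.abs_sum_le_sum_abs _ _).trans (Finset.sum_le_sum fun j _ => ?_)
    split_ifs
    · exact hh j
    · simp
  simp only [Finset.sum_const, Finset.card_univ, Fintype.card_fin, nsmul_eq_mul] at this
  calc |gowersVertex x h v| ≤ |x| + |∑ j, if v j then h j else 0| := abs_add_le _ _
    _ ≤ N + k * N := add_le_add hx this
    _ = _ := by ring

theorem mem_gowersCubes_bounds {k N : ℕ} {p : ℤ × (Fin k → ℤ)} (hp : p ∈ gowersCubes k N) :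
    p.1 ∈ Finset.Icc (1 : ℤ) N ∧ ∀ j, p.2 j ∈ Finset.Icc (-(N : ℤ)) N := by
  have := Finset.mem_product.1 (Finset.mem_filter.1 hp).1
  exact ⟨this.1, Fintype.mem_piFinset.1 this.2⟩

theorem card_gowersCubes_le {k N : ℕ} (hN : 1 ≤ N) : (gowersCubes k N).card ≤ (3 * N) ^ (k + 1) := by
  refine (Finset.card_filter_le _ _).trans ?_
  rw [Finset.card_product, Fintype.card_piFinset]
  simp only [Int.card_Icc, Finset.prod_const, Finset.card_univ, Fintype.card_fin]
  rw [pow_succ']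
  gcongr
  · omega
  · omega

theorem ZMod.val_intCast_of_mem {q N : ℕ} (hq : N < q) {a : ℤ} (ha : a ∈ Finset.Icc (1 : ℤ) N) :
    (((a : ZMod q).val : ℕ) : ℤ) = a := by
  rw [Finset.mem_Icc] at ha
  have : NeZero q := ⟨by omega⟩
  rw [ZMod.val_intCast, Int.emod_eq_of_lt] <;> omega

/-- For `q` this large no cube wraps around: a cube of `ZMod q` with all its vertices represented in
`[N]` lifts to exactly one integer cube in `[N]`. -/
theorem sum_gowersCubes_eq_gowersPower {k N q : ℕ} [NeZero q] (hq : (k + 4) * N < q)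
    (f : ℤ → ℂ) :
    ∑ p ∈ gowersCubes (k + 1) N, ∏ v : Fin (k + 1) → Bool, conjPow v (f (gowersVertex p.1 p.2 v)) =
      gowersPower k (zmodExtend q N f) := by
  have hNq : N < q := by nlinarith
  have hqz : ((k : ℤ) + 4) * N < q := by exact_mod_cast hq
  have h2q : 3 * N < q := by nlinarith
  have hvert (p : ℤ × (Fin (k + 1) → ℤ)) (v : Fin (k + 1) → Bool) :
      ((p.1 : ZMod q) + ∑ j, if v j then ((p.2 j : ℤ) : ZMod q) else 0) =
        (gowersVertex p.1 p.2 v : ZMod q) := by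
    simp only [gowersVertex]
    push_cast
    simp
  rw [← gowersForm_conjPow, gowersForm, ← Fintype.sum_prod_type']
  refine Finset.sum_of_injOn (fun p => ((p.1 : ZMod q), fun j => ((p.2 j : ℤ) : ZMod q)))
    ?_ (by simp) ?_ ?_
  · have aux (a b : ℤ) (ha : |a| ≤ N) (hb : |b| ≤ N) (h : (a : ZMod q) = b) : a = b := by
      rw [ZMod.intCast_eq_intCast_iff_dvd_sub] at h
      have := Int.eq_zero_of_abs_lt_dvd h (by rw [abs_le] at ha hb; rw [abs_lt]; constructor <;> omega)
      omega
    intro p hp p' hp' h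
    obtain ⟨h1, h2⟩ := mem_gowersCubes_bounds hp
    obtain ⟨h1', h2'⟩ := mem_gowersCubes_bounds hp'
    simp only [Finset.mem_Icc] at h1 h2 h1' h2'
    simp only [Prod.mk.injEq] at h
    refine Prod.ext (aux _ _ (abs_le.2 ⟨by omega, h1.2⟩) (abs_le.2 ⟨by omega, h1'.2⟩) h.1) ?_
    ext j
    exact aux _ _ (abs_le.2 (h2 j)) (abs_le.2 (h2' j)) (congr_fun h.2 j)
  · rintro ⟨n, h⟩ - hnot
    by_contra hne
    apply hnot
    have hv (v : Fin (k + 1) → Bool) : (n + ∑ j, if v j then h j else 0).val ∈ Finset.Icc 1 N := by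
      by_contra hv
      refine hne (Finset.prod_eq_zero (Finset.mem_univ v) ?_)
      simp only [zmodExtend, hv, if_false, conjPow]
      exact iterate_map_zero _ _
    have h0 := hv fun _ => false
    simp only [Bool.false_eq_true, if_false, Finset.sum_const_zero, add_zero] at h0
    have hj (j) := hv fun i => decide (i = j)
    simp only [decide_eq_true_eq, Finset.sum_ite_eq', Finset.mem_univ, if_true] at hj
    simp only [Finset.mem_Icc] at h0 hj hv
    -- The lifted edges are differences of representatives in `[1, N]`, hence at most `N` in
    -- absolute value.
    set p : ℤ × (Fin (k + 1) → ℤ) := ((n.val : ℤ), fun j => ((n + h j).val : ℤ) - n.val) with hp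
    have hpn : ((p.1 : ℤ) : ZMod q) = n := by simp [hp]
    have hph : (fun j => ((p.2 j : ℤ) : ZMod q)) = h := by ext j; simp [hp]
    refine ⟨p, ?_, Prod.ext hpn hph⟩
    refine (mem_gowersCubes p).2 fun v => ?_
    have ha := abs_gowersVertex_le (N := N) p.1 p.2 v (abs_le.2 (by simp only [hp]; omega)) fun j =>
      abs_le.2 (by have := hj j; simp only [hp]; omega)
    have e := hvert p v
    rw [hpn] at e
    have hph' (j) : ((p.2 j : ℤ) : ZMod q) = h j := congr_fun hph j
    simp only [hph'] at e
    have hv' := hv v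
    set z := n + ∑ j, if v j then h j else 0
    have e2 : ((gowersVertex p.1 p.2 v : ℤ) : ZMod q) = ((z.val : ℤ) : ZMod q) := by
      rw [← e]; simp
    rw [ZMod.intCast_eq_intCast_iff_dvd_sub] at e2
    -- The integer vertex is at most `(k + 2) * N` in absolute value and the representative at most
    -- `N`, so congruence modulo `q > (k + 4) * N` forces equality.
    have := Int.eq_zero_of_abs_lt_dvd e2 (by
      rw [abs_le] at ha
      push_cast at ha
      rw [abs_lt]
      constructor <;> nlinarith)
    rw [Finset.mem_Icc]
    omega
  · intro p hp
    refine Finset.prod_congr rfl fun v _ => ?_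
    have hv := (mem_gowersCubes p).1 hp v
    dsimp only
    rw [hvert]
    have := ZMod.val_intCast_of_mem hNq hv
    rw [Finset.mem_Icc] at hv
    rw [zmodExtend, if_pos (Finset.mem_Icc.2 (by omega)), this]

theorem gowersPower_zmodExtend_le {k N q : ℕ} [NeZero q] (hN : 1 ≤ N) (hq : (k + 4) * N < q)
    (f : ℤ → ℂ) (hf : gowersNorm (k + 1) N f ≤ 1) :
    gowersPower k (zmodExtend q N f) ≤ (3 * N) ^ (k + 2) := by
  rw [gowersNorm, sum_gowersCubes_eq_gowersPower hq] at hf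
  have h1 : ‖(gowersPower k (zmodExtend q N f) : ℂ) / ((gowersCubes (k + 1) N).card : ℂ)‖ ≤ 1 := by
    by_contra! h
    exact absurd hf (not_le.2 (Real.one_lt_rpow h (by positivity)))
  have hc : 0 < (gowersCubes (k + 1) N).card := by
    refine Finset.card_pos.2 ⟨(1, 0), (mem_gowersCubes _).2 fun v => ?_⟩
    simp [gowersVertex, hN]
  rw [norm_div, Complex.norm_real, Complex.norm_natCast, div_le_one (by exact_mod_cast hc),
    Real.norm_of_nonneg (gowersPower_nonneg _ _)] at h1
  exact h1.trans (by exact_mod_cast card_gowersCubes_le hN)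

theorem norm_gowersForm_le_of_gowersPower_le {k N q : ℕ} [NeZero q] (hq : 3 * N ≤ q)
    (b : (Fin (k + 1) → Bool) → ZMod q → ℂ)
    (hb : ∀ v, v ≠ (fun _ => false) → ∀ z, ‖b v z‖ ≤ 1)
    (h0 : gowersPower k (b fun _ => false) ≤ (3 * N) ^ (k + 2)) :
    ‖gowersForm (k + 1) b‖ ≤ (q : ℝ) ^ (k + 2) := by
  have h := norm_gowersForm_pow_le k b hb
  obtain ⟨m, hm⟩ : ∃ m, 2 ^ (k + 1) = m + 1 := ⟨2 ^ (k + 1) - 1, by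
    have := Nat.one_le_two_pow (n := k + 1); omega⟩
  rw [hm, ZMod.card, Nat.add_sub_cancel] at h
  refine le_of_pow_le_pow_left₀ (Nat.succ_ne_zero m) (by positivity) (h.trans ?_)
  calc (q : ℝ) ^ ((k + 2) * m) * gowersPower k (b fun _ => false)
      ≤ (q : ℝ) ^ ((k + 2) * m) * (q : ℝ) ^ (k + 2) := by
        gcongr
        refine h0.trans ?_
        gcongr
        exact_mod_cast hq
    _ = _ := by rw [← pow_add, ← pow_mul]; congr 1

/-- Used only for `s = 0`, where modulation invariance is unavailable but `F₁` is constant. -/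
theorem norm_sum_Icc_le_of_gowersNorm_one {N : ℕ} (hN : 1 ≤ N) (f : ℤ → ℂ)
    (hf : gowersNorm 1 N f ≤ 1) : ‖∑ n ∈ Finset.Icc 1 N, f (n : ℤ)‖ ≤ 5 * N := by
  have : NeZero (5 * N) := ⟨by omega⟩
  have h := norm_gowersForm_le_of_gowersPower_le (q := 5 * N) (k := 0) (N := N) (by omega)
    (fun v z => if v = (fun _ => false) then zmodExtend (5 * N) N f z else 1)
    (fun v hv z => by simp [hv])
    (by simpa using gowersPower_zmodExtend_le (k := 0) hN (by omega) f hf)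
  rw [gowersForm_succ_eq_sum_mul] at h
  have e1 (v : Fin 0 → Bool) : (Fin.cons false v : Fin (0 + 1) → Bool) = fun _ => false := by
    ext j; refine Fin.cases ?_ (fun i => i.elim0) j; simp
  have e2 (v : Fin 0 → Bool) : (Fin.cons true v : Fin (0 + 1) → Bool) ≠ fun _ => false := fun h => by
    simpa using congr_fun h 0
  have e3 : ∑ z, zmodExtend (5 * N) N f z = ∑ n ∈ Finset.Icc 1 N, f (n : ℤ) :=
    sum_zmod_eq_sum_Icc (by omega) fun n => f (n : ℤ)
  simp only [Fintype.prod_unique, e1, e2, if_true, if_false, Finset.sum_const,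
    Finset.card_univ, ZMod.card, norm_mul, Finset.univ_eq_empty, Fintype.card_unique, Nat.cast_one, one_mul, Finset.sum_empty, add_zero, e3,
    nsmul_eq_mul, mul_one, Complex.norm_natCast] at h
  have hN' : (0 : ℝ) < N := by exact_mod_cast hN
  push_cast at h
  refine le_of_mul_le_mul_right ?_ (by positivity : (0 : ℝ) < 5 * N)
  linarith

/-- The dual function associated with `b`, averaged over edges `u + v` with `u, v ∈ [0, N)^k`,
correlates boundedly with functions of Gowers norm at most `1`. -/
theorem norm_sum_dual_le {k N : ℕ} (hN : 1 ≤ N) (b : (Fin (k + 2) → Bool) → ℕ → ℂ)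
    (hb : ∀ v n, ‖b v n‖ ≤ 1) (f : ℤ → ℂ) (hf : gowersNorm (k + 2) N f ≤ 1) :
    ‖∑ n ∈ Finset.Icc 1 N, f (n : ℤ) * ∑ u : Fin (k + 2) → Fin N, ∑ u' : Fin (k + 2) → Fin N,
        ∏ v ∈ Finset.univ.erase (fun _ => false),
          b v (n + ∑ j, if v j then (u j : ℕ) + u' j else 0)‖ ≤
      (2 * k + 7 : ℝ) ^ (k + 3) * (N : ℝ) ^ (2 * k + 5) := by
  classical
  -- The vertices are at most `N + (k + 2) * 2N = (2k + 5) * N`, so they do not wrap around; `q`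
  -- also exceeds the `(k + 5) * N` needed to compare Gowers norms.
  set q := (2 * k + 7) * N with hqdef
  have hq0 : NeZero q := ⟨by positivity⟩
  have hq1 : (k + 1 + 4) * N < q := by rw [hqdef]; nlinarith
  have hq2 : N < q := by nlinarith
  set B : (Fin (k + 2) → Bool) → ZMod q → ℂ :=
    fun v z => if v = (fun _ => false) then zmodExtend q N f z else b v z.val with hB
  set T : (Fin (k + 2) → ZMod q) → ℂ :=
    fun h => ∑ n, ∏ v, B v (n + ∑ j, if v j then h j else 0) with hT
  set e : (Fin (k + 2) → Fin N) → Fin (k + 2) → ZMod q := fun u j => ((u j : ℕ) : ZMod q) with he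
  have hsum : ∑ n ∈ Finset.Icc 1 N, f (n : ℤ) *
      ∑ u : Fin (k + 2) → Fin N, ∑ u' : Fin (k + 2) → Fin N,
        ∏ v ∈ Finset.univ.erase (fun _ => false),
          b v (n + ∑ j, if v j then (u j : ℕ) + u' j else 0) = ∑ u, ∑ u', T (e u + e u') := by
    simp only [Finset.mul_sum]
    rw [Finset.sum_comm]
    refine Finset.sum_congr rfl fun u _ => ?_
    rw [Finset.sum_comm]
    refine Finset.sum_congr rfl fun u' _ => ?_
    rw [hT, ← sum_zmod_eq_sum_Icc hq2 fun n => f (n : ℤ) *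
        ∏ v ∈ Finset.univ.erase (fun _ => false),
          b v (n + ∑ j, if v j then (u j : ℕ) + u' j else 0)]
    refine Finset.sum_congr rfl fun z _ => ?_
    rw [← Finset.mul_prod_erase _ _ (Finset.mem_univ fun _ => false)]
    simp only [hB, if_true, Bool.false_eq_true, if_false, Finset.sum_const_zero, add_zero, zmodExtend]
    split_ifs with hz
    · congr 1
      refine Finset.prod_congr rfl fun v hv => ?_
      rw [if_neg (Finset.ne_of_mem_erase hv)]
      congr 1
      have hs : ∑ j, (if v j then (u j : ℕ) + u' j else 0) ≤ ∑ _j : Fin (k + 2), 2 * N := by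
        refine Finset.sum_le_sum fun j _ => ?_
        split_ifs
        · have := (u j).2; have := (u' j).2; omega
        · omega
      simp only [Finset.sum_const, Finset.card_univ, Fintype.card_fin, smul_eq_mul] at hs
      rw [Finset.mem_Icc] at hz
      have : z + ∑ j, (if v j then (e u + e u') j else 0) =
          ((z.val + ∑ j, (if v j then (u j : ℕ) + u' j else 0) : ℕ) : ZMod q) := by
        push_cast
        simp [he]
      rw [this, ZMod.val_cast_of_lt]
      nlinarith [hqdef.ge, hz.2]
    · simp
  have hinj : Function.Injective e := by
    intro u u' h
    ext j
    have h1 : ((u j : ℕ) : ZMod q) = ((u' j : ℕ) : ZMod q) := congr_fun h j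
    rwa [ZMod.natCast_eq_natCast_iff, Nat.ModEq, Nat.mod_eq_of_lt ((u j).2.trans hq2),
      Nat.mod_eq_of_lt ((u' j).2.trans hq2)] at h1
  have hfour (ψ : AddChar (Fin (k + 2) → ZMod q) ℂ) : ‖∑ h, T h * ψ h‖ ≤ (q : ℝ) ^ (k + 3) := by
    set ψ' : Fin (k + 2) → AddChar (ZMod q) ℂ :=
      fun j => ψ.compAddMonoidHom (AddMonoidHom.single (fun _ => ZMod q) j) with hψ'
    have hψ (h) : ψ h = ∏ j, ψ' j (h j) := by
      conv_lhs => rw [← Finset.univ_sum_single h]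
      exact map_prod ψ.toMonoidHom (fun j => Multiplicative.ofAdd (Pi.single j (h j))) _
    -- Since `ψ' j (h j) = ψ' j (n + h j) * (ψ' j n)⁻¹`, the character of the edges is spread over
    -- the base vertex and its neighbours `n + h j`.
    set χ : (Fin (k + 2) → Bool) → AddChar (ZMod q) ℂ := fun v =>
      ∏ j, if v = (fun _ => false) then (ψ' j)⁻¹ else if v = (fun i => decide (i = j)) then ψ' j else 1
      with hχ
    have hprod (n : ZMod q) (h : Fin (k + 2) → ZMod q) :
        ∏ v, χ v (n + ∑ j, if v j then h j else 0) = ψ h := by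
      simp only [hχ, AddChar.prod_apply]
      rw [Finset.prod_comm, hψ]
      refine Finset.prod_congr rfl fun j _ => ?_
      have hne : (fun i => decide (i = j) : Fin (k + 2) → Bool) ≠ fun _ => false := fun h => by
        simpa using congr_fun h j
      rw [Fintype.prod_eq_mul (fun _ => false) (fun i => decide (i = j)) hne.symm]
      · simp [hne, AddChar.map_add_eq_mul, AddChar.inv_apply]
        rw [← mul_assoc, ← AddChar.map_add_eq_mul]
        simp
      · rintro v ⟨h1, h2⟩
        simp [h1, h2]
    have h1 : ∑ h, T h * ψ h = gowersForm (k + 2) fun v z => χ v z * B v z := by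
      rw [gowersForm, Finset.sum_comm]
      refine Finset.sum_congr rfl fun h _ => ?_
      rw [hT, Finset.sum_mul]
      refine Finset.sum_congr rfl fun n _ => ?_
      rw [Finset.prod_mul_distrib, hprod, mul_comm]
    rw [h1]
    refine norm_gowersForm_le_of_gowersPower_le (N := N) (by rw [hqdef]; nlinarith) _ ?_ ?_
    · intro v hv z
      simpa [AddChar.norm_apply, hB, hv] using hb v _
    · rw [gowersPower_addChar_mul]
      simpa [hB] using gowersPower_zmodExtend_le hN hq1 f hf
  rw [hsum]
  refine (norm_sum_add_le_of_fourier T _ hfour Finset.univ e hinj.injOn).trans_eq ?_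
  simp only [Finset.card_univ, Fintype.card_fun, Fintype.card_fin, hqdef]
  push_cast
  rw [mul_pow]
  ring

/-! ### Iterated square roots near the identity of a Lie group. -/

section Roots

open Filter Topology

/-- `y` has iterated square roots tending to the identity. -/
def HasVanishingRoots {G : Type*} [Group G] [TopologicalSpace G] (y : G) : Prop :=
  ∃ r : ℕ → G, (∀ n, r n ^ 2 ^ n = y) ∧ Tendsto r atTop (𝓝 1)

/-- In a chart multiplication has derivative `(v, w) ↦ v + w` at the identity, so squaring has
derivative `2`. Its local inverse contracts towards the identity, and iterating it produces the
roots without the exponential map. -/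
theorem eventually_hasVanishingRoots {E : Type*} [NormedAddCommGroup E] [NormedSpace ℝ E]
    [CompleteSpace E] {G : Type*} [Group G] [TopologicalSpace G] [ChartedSpace E G]
    [LieGroup 𝓘(ℝ, E) ∞ G] : ∀ᶠ y in 𝓝 (1 : G), HasVanishingRoots y := by
  have : IsTopologicalGroup G := topologicalGroup_of_lieGroup 𝓘(ℝ, E) ∞
  set φ := extChartAt 𝓘(ℝ, E) (1 : G) with hφ
  set e := φ 1 with he
  have hsymm : φ.symm e = 1 := extChartAt_to_inv 1
  set m : E × E → E := fun p => φ (φ.symm p.1 * φ.symm p.2) with hm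
  have hφs : ContMDiffAt 𝓘(ℝ, E) 𝓘(ℝ, E) ∞ φ.symm e :=
    (contMDiffOn_extChartAt_symm (1 : G)).contMDiffAt (extChartAt_target_mem_nhds (1 : G))
  have hmdiff : ContDiffAt ℝ ∞ m (e, e) := by
    rw [← contMDiffAt_iff_contDiffAt]
    have h1 : ContMDiffAt 𝓘(ℝ, E × E) 𝓘(ℝ, E) ∞ (fun p : E × E => φ.symm p.1) (e, e) :=
      ContMDiffAt.comp (x := (e, e)) (g := φ.symm) (f := Prod.fst) hφs
        contDiff_fst.contMDiff.contMDiffAt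
    have h2 : ContMDiffAt 𝓘(ℝ, E × E) 𝓘(ℝ, E) ∞ (fun p : E × E => φ.symm p.2) (e, e) :=
      ContMDiffAt.comp (x := (e, e)) (g := φ.symm) (f := Prod.snd) hφs
        contDiff_snd.contMDiff.contMDiffAt
    refine ContMDiffAt.comp (x := (e, e)) (g := φ) (f := fun p : E × E => φ.symm p.1 * φ.symm p.2)
      ?_ (h1.mul h2)
    simp only [hsymm, mul_one]
    exact contMDiffAt_extChartAt
  have hφright : ∀ᶠ v in 𝓝 e, φ (φ.symm v) = v := by
    filter_upwards [extChartAt_target_mem_nhds (I := 𝓘(ℝ, E)) (1 : G)] with v hv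
    exact φ.right_inv hv
  have hstrict := hmdiff.hasStrictFDerivAt (by simp)
  set m' := fderiv ℝ m (e, e)
  have hm1 (v : E) : m' (v, 0) = v := by
    have h1 : HasFDerivAt (fun v => m (v, e)) (m'.comp (.inl ℝ E E)) e :=
      HasFDerivAt.comp (g := m) (f := fun v => (v, e)) e hstrict.hasFDerivAt
        (hasFDerivAt_prodMk_left e e)
    have h2 : HasFDerivAt (fun v => m (v, e)) (.id ℝ E) e :=
      (hasFDerivAt_id e).congr_of_eventuallyEq (by
        filter_upwards [hφright] with v hv
        simp [hm, hsymm, hv])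
    simpa using congr($(h1.unique h2) v)
  have hm2 (v : E) : m' (0, v) = v := by
    have h1 : HasFDerivAt (fun v => m (e, v)) (m'.comp (.inr ℝ E E)) e :=
      HasFDerivAt.comp (g := m) (f := fun v => (e, v)) e hstrict.hasFDerivAt
        (hasFDerivAt_prodMk_right e e)
    have h2 : HasFDerivAt (fun v => m (e, v)) (.id ℝ E) e :=
      (hasFDerivAt_id e).congr_of_eventuallyEq (by
        filter_upwards [hφright] with v hv
        simp [hm, hsymm, hv])
    simpa using congr($(h1.unique h2) v)
  set two : E ≃L[ℝ] E := ContinuousLinearEquiv.smulLeft (Units.mk0 (2 : ℝ) two_ne_zero)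
  set sq : E → E := fun v => m (v, v) with hsq
  have hsqe : sq e = e := by
    change φ (φ.symm e * φ.symm e) = e
    rw [hsymm, mul_one]
  have hsq' : HasStrictFDerivAt sq (two : E →L[ℝ] E) e := by
    have h := HasStrictFDerivAt.comp e (f := fun v : E => (v, v)) (g := m) hstrict
      ((hasStrictFDerivAt_id e).prodMk (hasStrictFDerivAt_id e))
    refine h.congr_fderiv ?_
    ext v
    have : ((v, v) : E × E) = (v, 0) + (0, v) := by simp
    simp only [ContinuousLinearMap.comp_apply, ContinuousLinearMap.prod_apply,
      ContinuousLinearMap.id_apply]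
    rw [this, map_add, hm1, hm2, ← two_smul ℝ v]
    rfl
  set ρ := hsq'.localInverse sq two e
  have hρe : ρ e = e := by
    have := hsq'.localInverse_apply_image
    rwa [hsqe] at this
  have hρ' : HasFDerivAt ρ (two.symm : E →L[ℝ] E) e := by
    have := hsq'.to_localInverse.hasFDerivAt
    rwa [hsqe] at this
  have hρsq : ∀ᶠ v in 𝓝 e, sq (ρ v) = v := by
    have := hsq'.eventually_right_inverse
    rwa [hsqe] at this
  -- The derivative of `ρ` is `1 / 2`; the other `1 / 4` absorbs the error term.
  have hρlip : ∀ᶠ v in 𝓝 e, ‖ρ v - e‖ ≤ 3 / 4 * ‖v - e‖ := by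
    have := hρ'.isLittleO.def (c := 1 / 4) (by norm_num)
    filter_upwards [this] with v hv
    rw [hρe] at hv
    have h2 : (two.symm : E →L[ℝ] E) (v - e) = (2 : ℝ)⁻¹ • (v - e) := rfl
    rw [h2] at hv
    calc ‖ρ v - e‖ = ‖(ρ v - e - (2 : ℝ)⁻¹ • (v - e)) + (2 : ℝ)⁻¹ • (v - e)‖ := by
          rw [sub_add_cancel]
      _ ≤ 1 / 4 * ‖v - e‖ + 2⁻¹ * ‖v - e‖ := (norm_add_le _ _).trans (add_le_add hv (by
          rw [norm_smul]; simp))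
      _ = _ := by ring
  have hsource : ∀ᶠ v in 𝓝 e, φ.symm v * φ.symm v ∈ φ.source := by
    have hc : ContinuousAt (fun v => φ.symm v * φ.symm v) e :=
      hφs.continuousAt.mul hφs.continuousAt
    refine hc.eventually_mem ?_
    simp only [hsymm, mul_one]
    exact extChartAt_source_mem_nhds (I := 𝓘(ℝ, E)) (1 : G)
  have hρsource : ∀ᶠ v in 𝓝 e, φ.symm (ρ v) * φ.symm (ρ v) ∈ φ.source := by
    have := hρ'.continuousAt
    rw [ContinuousAt, hρe] at this
    exact this.eventually hsource
  obtain ⟨δ, hδ, hball⟩ := Metric.eventually_nhds_iff.1 (hρsq.and (hρlip.and hρsource))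
  have hφc : Tendsto φ (𝓝 1) (𝓝 e) := continuousAt_extChartAt (I := 𝓘(ℝ, E)) (1 : G)
  filter_upwards [hφc.eventually (Metric.ball_mem_nhds e hδ),
    extChartAt_source_mem_nhds (I := 𝓘(ℝ, E)) (1 : G)]
    with y hy hys
  set v : ℕ → E := fun n => ρ^[n] (φ y) with hv
  have hvs (n : ℕ) : v (n + 1) = ρ (v n) := Function.iterate_succ_apply' _ _ _
  have hbound (n : ℕ) : ‖v n - e‖ ≤ (3 / 4) ^ n * ‖φ y - e‖ ∧ dist (v n) e < δ := by
    induction n with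
    | zero => exact ⟨by simp [hv], hy⟩
    | succ n ih =>
      have h1 := (hball ih.2).2.1
      rw [← hvs] at h1
      refine ⟨h1.trans (by rw [pow_succ]; linarith [ih.1]), lt_of_le_of_lt ?_ ih.2⟩
      rw [dist_eq_norm, dist_eq_norm]
      linarith [norm_nonneg (v n - e)]
  have hsqv (n : ℕ) : φ.symm (v (n + 1)) ^ 2 = φ.symm (v n) := by
    obtain ⟨h1, -, h2⟩ := hball (hbound n).2
    rw [← hvs] at h1 h2
    rw [pow_two, ← h1]
    exact (φ.left_inv h2).symm
  refine ⟨fun n => φ.symm (v n), fun n => ?_, ?_⟩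
  · induction n with
    | zero => simpa [hv] using φ.left_inv hys
    | succ n ih => rw [pow_succ', pow_mul, hsqv, ih]
  · have : Tendsto v atTop (𝓝 e) := by
      rw [tendsto_iff_norm_sub_tendsto_zero]
      refine squeeze_zero (fun _ => norm_nonneg _) (fun n => (hbound n).1) ?_
      simpa using (tendsto_pow_atTop_nhds_zero_of_lt_one (by norm_num : (0 : ℝ) ≤ 3 / 4)
        (by norm_num)).mul_const ‖φ y - e‖
    have h := hφs.continuousAt.tendsto.comp this
    rwa [hsymm] at h

/-- A subgroup containing a neighbourhood of `1` is open, hence closed, hence everything by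
connectedness. -/
theorem closure_hasVanishingRoots {G : Type*} [Group G] [TopologicalSpace G] [IsTopologicalGroup G]
    [PreconnectedSpace G] (h : ∀ᶠ y in 𝓝 (1 : G), HasVanishingRoots y) :
    Subgroup.closure {y : G | HasVanishingRoots y} = ⊤ := by
  have ho := Subgroup.isOpen_of_mem_nhds (Subgroup.closure {y : G | HasVanishingRoots y})
    (mem_of_superset h Subgroup.subset_closure)
  have hc := Subgroup.isClosed_of_isOpen _ ho
  exact SetLike.coe_injective (IsClopen.eq_univ ⟨hc, ho⟩ ⟨1, one_mem _⟩)

end Roots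

/-! ### Commutators modulo a subgroup and their compactness. -/

section Commutators

open scoped commutatorElement

section CentralCommutators

variable {Q : Type*} [Group Q]

theorem commutator_mul_right_of_central {q a b : Q} (h : ⁅q, b⁆ ∈ Subgroup.center Q) :
    ⁅q, a * b⁆ = ⁅q, a⁆ * ⁅q, b⁆ := by
  rw [commutatorElement_mul_right_eq_mul_conj, mul_assoc ⁅q, a⁆, Subgroup.mem_center_iff.1 h a]
  group

theorem commutator_mul_left_of_central {p q a : Q} (h : ⁅q, a⁆ ∈ Subgroup.center Q) :
    ⁅p * q, a⁆ = ⁅q, a⁆ * ⁅p, a⁆ := by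
  rw [commutatorElement_mul_left_eq_conj_mul, Subgroup.mem_center_iff.1 h p]
  group

theorem commutator_pow_left_of_central {q a : Q} (h : ⁅q, a⁆ ∈ Subgroup.center Q) (n : ℕ) :
    ⁅q ^ n, a⁆ = ⁅q, a⁆ ^ n := by
  induction n with
  | zero => simp
  | succ n ih => rw [pow_succ, commutator_mul_left_of_central h, ih, pow_succ']

/-- `x ↦ ⁅q, x⁆` as a homomorphism, when its values are central. -/
def commutatorHom (q : Q) (h : ∀ x, ⁅q, x⁆ ∈ Subgroup.center Q) : Q →* Q where
  toFun x := ⁅q, x⁆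
  map_one' := by simp
  map_mul' _ b := commutator_mul_right_of_central (h b)

/-- The elements whose commutators with everything lie in the normal subgroup `N`. -/
def centralMod (N : Subgroup Q) [N.Normal] : Subgroup Q :=
  (Subgroup.center (Q ⧸ N)).comap (QuotientGroup.mk' N)

theorem mem_centralMod {N : Subgroup Q} [N.Normal] {y : Q} :
    y ∈ centralMod N ↔ ∀ x, ⁅y, x⁆ ∈ N := by
  rw [centralMod, Subgroup.mem_comap, Subgroup.mem_center_iff]
  have (x : Q) : ⁅y, x⁆ ∈ N ↔ QuotientGroup.mk' N x * QuotientGroup.mk' N y =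
      QuotientGroup.mk' N y * QuotientGroup.mk' N x := by
    rw [← (QuotientGroup.eq_one_iff (N := N) ⁅y, x⁆), eq_comm (a := QuotientGroup.mk' N x * _),
      ← commutatorElement_eq_one_iff_mul_comm, ← map_commutatorElement]
    rfl
  simp only [this]
  exact ⟨fun h x => h _, fun h x => by obtain ⟨x, rfl⟩ := QuotientGroup.mk'_surjective N x; exact h x⟩

theorem isClosed_centralMod [TopologicalSpace Q] [IsTopologicalGroup Q] {N : Subgroup Q} [N.Normal]
    (hN : IsClosed (N : Set Q)) : IsClosed (centralMod N : Set Q) := by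
  have : (centralMod N : Set Q) = ⋂ x, (fun y => ⁅y, x⁆) ⁻¹' (N : Set Q) := by
    ext y
    simp only [SetLike.mem_coe, mem_centralMod, Set.mem_iInter, Set.mem_preimage]
  rw [this]
  refine isClosed_iInter fun x => hN.preimage ?_
  simp only [commutatorElement_def]
  fun_prop

end CentralCommutators

section CocompactCommutators

open Filter Topology Pointwise

variable {G : Type*} [Group G] [TopologicalSpace G] [IsTopologicalGroup G]

/-- Modulo `T`, each `x ↦ ⁅δ, x⁆` is a homomorphism with central values that kills `Γ`, so its range
is already the image of the compact set `K₀`. Finitely many such ranges multiply to a compact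
central subgroup. -/
theorem exists_compact_central_subgroup {Γ : Subgroup G} {K₀ : Set G} (hK₀ : IsCompact K₀)
    (hcov : ∀ g, ∃ k ∈ K₀, ∃ γ ∈ Γ, g = k * γ) {C C' D T : Subgroup G} [T.Normal]
    (hCC' : ⁅C, ⊤⁆ ≤ C') (hC'T : ⁅C', ⊤⁆ ≤ T) (hDC : D ≤ C) (hDΓ : ⁅D, Γ⁆ ≤ T)
    (F : Finset G) (hFD : ∀ δ ∈ F, δ ∈ D) :
    ∃ K : Set G, IsCompact K ∧ K ⊆ ((⁅C, ⊤⁆ : Subgroup G) : Set G) ∧ ∃ A : Subgroup (G ⧸ T),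
      A ≤ Subgroup.center (G ⧸ T) ∧ (A : Set (G ⧸ T)) = QuotientGroup.mk' T '' K ∧
        ∀ δ ∈ F, ∀ x, QuotientGroup.mk' T ⁅δ, x⁆ ∈ A := by
  classical
  set pr := QuotientGroup.mk' T
  have hcent {y : G} (hy : y ∈ C) (x : G ⧸ T) : ⁅pr y, x⁆ ∈ Subgroup.center (G ⧸ T) := by
    obtain ⟨x, rfl⟩ := QuotientGroup.mk'_surjective T x
    rw [← map_commutatorElement]
    change ⁅y, x⁆ ∈ centralMod T
    exact mem_centralMod.2 fun g => hC'T (Subgroup.commutator_mem_commutator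
      (hCC' (Subgroup.commutator_mem_commutator hy (Subgroup.mem_top _))) (Subgroup.mem_top _))
  induction F using Finset.induction_on with
  | empty => exact ⟨{1}, isCompact_singleton, by simp, ⊥, bot_le, by simp, by simp⟩
  | insert δ F _ ih =>
    obtain ⟨K, hK, hKC, A, hA, hAK, hAF⟩ := ih fun δ' h => hFD δ' (Finset.mem_insert_of_mem h)
    have hδ := hFD δ (Finset.mem_insert_self _ _)
    set B := (commutatorHom (pr δ) (hcent (hDC hδ))).range with hB
    have hBc : B ≤ Subgroup.center (G ⧸ T) := by
      rintro _ ⟨x, rfl⟩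
      exact hcent (hDC hδ) x
    have hBn : B.Normal := ⟨fun b hb g => by
      rw [Subgroup.mem_center_iff.1 (hBc hb) g, mul_inv_cancel_right]; exact hb⟩
    have hBK : (B : Set (G ⧸ T)) = pr '' ((fun k => ⁅δ, k⁆) '' K₀) := by
      ext b
      constructor
      · rintro ⟨x, rfl⟩
        obtain ⟨x, rfl⟩ := QuotientGroup.mk'_surjective T x
        obtain ⟨k, hk, γ, hγ, rfl⟩ := hcov x
        refine ⟨_, ⟨k, hk, rfl⟩, ?_⟩
        change pr ⁅δ, k⁆ = ⁅pr δ, pr (k * γ)⁆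
        have h1 : ⁅pr δ, pr γ⁆ = 1 := by
          rw [← map_commutatorElement]
          exact (QuotientGroup.eq_one_iff _).2 (hDΓ (Subgroup.commutator_mem_commutator hδ hγ))
        rw [map_mul, commutator_mul_right_of_central (hcent (hDC hδ) _), h1, mul_one,
          map_commutatorElement]
      · rintro ⟨_, ⟨k, -, rfl⟩, rfl⟩
        exact ⟨pr k, (map_commutatorElement pr δ k).symm⟩
    refine ⟨K * (fun k => ⁅δ, k⁆) '' K₀, hK.mul (hK₀.image ?_), ?_, A ⊔ B, sup_le hA hBc, ?_, ?_⟩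
    · simp only [commutatorElement_def]
      fun_prop
    · rintro _ ⟨a, ha, _, ⟨k, -, rfl⟩, rfl⟩
      exact mul_mem (hKC ha) (Subgroup.commutator_mem_commutator (hDC hδ) (Subgroup.mem_top _))
    · rw [Subgroup.mul_normal, hAK, hBK, Set.image_mul]
    · intro δ' h x
      rcases Finset.mem_insert.1 h with rfl | h
      · exact Subgroup.mem_sup_right ⟨pr x, (map_commutatorElement pr _ x).symm⟩
      · exact Subgroup.mem_sup_left (hAF δ' h x)

theorem eventually_commutator_mem {K : Set G} (hK : IsCompact K) {V : Set G} (hV : V ∈ 𝓝 (1 : G)) :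
    ∀ᶠ r in 𝓝 (1 : G), ∀ k ∈ K, ⁅k, r⁆ ∈ V := by
  refine hK.eventually_forall_of_forall_eventually fun k _ => ?_
  have hc : Continuous fun z : G × G => ⁅z.2, z.1⁆ := by
    simp only [commutatorElement_def]
    fun_prop
  exact hc.continuousAt.eventually_mem (by simpa using hV)

/-- One step of the passage from `C_i` to `C_{i+1}` in the lower central series: the commutator
subgroup is covered by a compact set modulo `T`. -/
theorem exists_compact_commutator_subset
    (hroots : Subgroup.closure {y : G | HasVanishingRoots y} = ⊤)
    {Γ : Subgroup G} {K₀ : Set G} (hK₀ : IsCompact K₀)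
    (hcov : ∀ g, ∃ k ∈ K₀, ∃ γ ∈ Γ, g = k * γ) {C C' D T : Subgroup G} [T.Normal]
    (hT : IsClosed (T : Set G))
    (hCC' : ⁅C, ⊤⁆ ≤ C') (hC'T : ⁅C', ⊤⁆ ≤ T) (hDC : D ≤ C) (hDΓ : ⁅D, Γ⁆ ≤ T)
    {F : Set G} (hFfin : F.Finite) (hFD : F ⊆ D) (hF : D ≤ Subgroup.closure F ⊔ C')
    {K : Set G} (hK : IsCompact K)
    (hCK : (C : Set G) ⊆ K * ((D ⊔ C').topologicalClosure : Set G)) :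
    ∃ K' : Set G, IsCompact K' ∧ K' ⊆ ((⁅C, ⊤⁆ : Subgroup G) : Set G) ∧
      ((⁅C, ⊤⁆ : Subgroup G) : Set G) ⊆ K' * (T : Set G) := by
  obtain ⟨K', hK', hK'C, A, hA, hAK, hAF⟩ := exists_compact_central_subgroup hK₀ hcov hCC' hC'T
    hDC hDΓ hFfin.toFinset fun δ h => hFD (by simpa using h)
  set pr := QuotientGroup.mk' T with hpr
  set B := A.comap pr with hB
  have hAn : A.Normal := ⟨fun b hb g => by
    rw [Subgroup.mem_center_iff.1 (hA hb) g, mul_inv_cancel_right]; exact hb⟩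
  have hprc : Continuous pr := QuotientGroup.continuous_mk
  have hAcl : IsClosed (A : Set (G ⧸ T)) := by
    rw [hAK]
    have : T3Space (G ⧸ T) := QuotientGroup.instT3Space (hN := hT) T
    exact (hK'.image hprc).isClosed
  have hBcl : IsClosed (B : Set G) := hAcl.preimage hprc
  have hTB : T ≤ B := fun t ht => by
    rw [hB, Subgroup.mem_comap, show pr t = 1 from (QuotientGroup.eq_one_iff t).2 ht]
    exact one_mem _
  have hBK : (B : Set G) ⊆ K' * (T : Set G) := by
    intro b hb
    have : pr b ∈ (A : Set (G ⧸ T)) := hb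
    rw [hAK] at this
    obtain ⟨k, hk, hkb⟩ := this
    exact ⟨k, hk, k⁻¹ * b, QuotientGroup.eq.1 hkb, by simp⟩
  have hC' : C' ≤ centralMod B := fun y hy => mem_centralMod.2 fun x =>
    hTB (hC'T (Subgroup.commutator_mem_commutator hy (Subgroup.mem_top _)))
  -- Being central modulo the closed subgroup `B` is a closed condition, so it may be checked on the
  -- finite set `F` and on `C'`.
  have hS : (D ⊔ C').topologicalClosure ≤ centralMod B := by
    refine Subgroup.topologicalClosure_minimal _ (sup_le (hF.trans (sup_le ?_ hC')) hC')
      (isClosed_centralMod hBcl)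
    rw [Subgroup.closure_le]
    exact fun δ hδ => mem_centralMod.2 fun x => hAF δ (by simpa using hδ) x
  have hcent {y : G} (hy : y ∈ C) (x : G) : ⁅pr y, pr x⁆ ∈ Subgroup.center (G ⧸ T) := by
    rw [← map_commutatorElement]
    change ⁅y, x⁆ ∈ centralMod T
    exact mem_centralMod.2 fun g => hC'T (Subgroup.commutator_mem_commutator
      (hCC' (Subgroup.commutator_mem_commutator hy (Subgroup.mem_top _))) (Subgroup.mem_top _))
  have hroot {y x : G} (hy : y ∈ C) (hx : HasVanishingRoots x) : ⁅y, x⁆ ∈ B := by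
    obtain ⟨r, hr, hr1⟩ := hx
    -- Bilinearity moves the exponent: `⁅y, x⁆ = ⁅y, r n ^ 2 ^ n⁆ = ⁅y ^ 2 ^ n, r n⁆` modulo `T`.
    -- Writing `y ^ 2 ^ n = k * t`, the factor `t` is central modulo `B`, so only `⁅k, r n⁆`
    -- remains.
    have hks (n : ℕ) : ∃ k ∈ K, ⁅y, x⁆ * ⁅k, r n⁆⁻¹ ∈ B := by
      obtain ⟨k, hk, t, ht, hkt⟩ := hCK (pow_mem hy (2 ^ n))
      refine ⟨k, hk, ?_⟩
      have h1 : pr ⁅y, x⁆ = pr ⁅y ^ 2 ^ n, r n⁆ := by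
        rw [map_commutatorElement, map_commutatorElement, map_pow,
          commutator_pow_left_of_central (hcent hy _), ← hr n, map_pow]
        have := map_pow (commutatorHom (pr y) fun z => by
          obtain ⟨z, rfl⟩ := QuotientGroup.mk'_surjective T z
          exact hcent hy z) (pr (r n)) (2 ^ n)
        exact this
      have h2 : k * ⁅t, r n⁆ * k⁻¹ ∈ B :=
        (inferInstance : B.Normal).conj_mem _ (mem_centralMod.1 (hS ht) _) _
      change pr _ ∈ A
      rw [map_mul, h1, ← map_mul, ← hkt]
      change ⁅k * t, r n⁆ * ⁅k, r n⁆⁻¹ ∈ B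
      rwa [commutatorElement_mul_left_eq_conj_mul, mul_inv_cancel_right]
    choose k hkK hkB using hks
    -- The `k n` stay in a compact set while `r n` tends to `1`; closedness of `B` then gives `⁅y,
    -- x⁆ ∈ B`.
    have hlim : Tendsto (fun n => ⁅k n, r n⁆) atTop (𝓝 1) := by
      intro V hV
      rw [Filter.mem_map]
      filter_upwards [hr1.eventually (eventually_commutator_mem hK hV)] with n hn
      exact hn _ (hkK n)
    have := (hlim.inv.const_mul ⁅y, x⁆)
    rw [inv_one, mul_one] at this
    exact hBcl.mem_of_tendsto this (Eventually.of_forall hkB)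
  have hall : ⁅C, (⊤ : Subgroup G)⁆ ≤ B := by
    rw [Subgroup.commutator_le]
    intro y hy x hx'
    clear hx'
    have hx : x ∈ Subgroup.closure {y : G | HasVanishingRoots y} := hroots ▸ Subgroup.mem_top x
    induction hx using Subgroup.closure_induction with
    | mem x hx => exact hroot hy hx
    | one => simp
    | mul a b _ _ ha hb =>
      rw [commutatorElement_mul_right_eq_mul_conj, mul_assoc ⁅y, a⁆, mul_assoc ⁅y, a⁆]
      exact mul_mem ha ((inferInstance : B.Normal).conj_mem _ hb _)
    | inv a _ ha =>
      rw [commutatorElement_inv_right, ← commutatorElement_inv]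
      simpa using (inferInstance : B.Normal).conj_mem _ (inv_mem ha) a⁻¹
  exact ⟨K', hK', hK'C, fun b hb => hBK (hall hb)⟩

end CocompactCommutators

/-! ### Compact fundamental sets and finite generation of the lattice. -/

section Cover

open Filter Topology Pointwise

variable {G : Type*} [Group G] [TopologicalSpace G] [IsTopologicalGroup G]

theorem exists_isOpen_isCompact_cover [LocallyCompactSpace G] (Γ : Subgroup G)
    [CompactSpace (G ⧸ Γ)] :
    ∃ U K : Set G, IsOpen U ∧ IsCompact K ∧ U ⊆ K ∧ ∀ g, ∃ u ∈ U, ∃ γ ∈ Γ, g = u * γ := by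
  choose K hK hK1 using fun g : G => exists_compact_mem_nhds g
  obtain ⟨t, ht⟩ := isCompact_univ.elim_finite_subcover
    (fun g : G => (QuotientGroup.mk : G → G ⧸ Γ) '' interior (K g))
    (fun g => QuotientGroup.isOpenMap_coe _ isOpen_interior) (by
      intro x _
      obtain ⟨g, rfl⟩ := QuotientGroup.mk_surjective x
      exact Set.mem_iUnion.2 ⟨g, g, mem_interior_iff_mem_nhds.2 (hK1 g), rfl⟩)
  refine ⟨⋃ g ∈ t, interior (K g), ⋃ g ∈ t, K g, isOpen_biUnion fun _ _ => isOpen_interior,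
    t.isCompact_biUnion fun g _ => hK g, Set.iUnion₂_mono fun _ _ => interior_subset, fun g => ?_⟩
  obtain ⟨a, ha, u, hu, hug⟩ := Set.mem_iUnion₂.1 (ht (Set.mem_univ (g : G ⧸ Γ)))
  exact ⟨u, Set.mem_iUnion₂.2 ⟨a, ha, hu⟩, u⁻¹ * g, QuotientGroup.eq.1 hug, by group⟩

/-- Translates `U * γ` and `U * γ'` meet only if `γ' * γ⁻¹` lies in the finite set `K⁻¹ * K ∩ Γ`. If
`Δ` is generated by that set, `U * Δ` and `U * (Γ \ Δ)` are complementary open sets, and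
connectedness gives `Δ = Γ`. -/
theorem exists_finite_closure_eq [LocallyCompactSpace G] [T2Space G] [PreconnectedSpace G]
    (Γ : Subgroup G) [DiscreteTopology Γ] [CompactSpace (G ⧸ Γ)] :
    ∃ F : Set G, F.Finite ∧ Subgroup.closure F = Γ := by
  obtain ⟨U, K, hU, hK, hUK, hcov⟩ := exists_isOpen_isCompact_cover Γ
  have hΓ : IsClosed (Γ : Set G) := Subgroup.isClosed_of_discrete
  set F : Set G := (K⁻¹ * K) ∩ Γ with hF
  have hFfin : F.Finite := by
    have hd : DiscreteTopology F := DiscreteTopology.of_subset (s := (Γ : Set G))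
      ‹_› Set.inter_subset_right
    exact ((hK.inv.mul hK).inter_right hΓ).finite ⟨hd⟩
  refine ⟨F, hFfin, le_antisymm ((Subgroup.closure_le _).2 Set.inter_subset_right) ?_⟩
  set Δ := Subgroup.closure F
  have hΔΓ : Δ ≤ Γ := (Subgroup.closure_le _).2 Set.inter_subset_right
  have hkey {u u' γ γ' : G} (hu : u ∈ U) (hu' : u' ∈ U) (hγ : γ ∈ Γ) (hγ' : γ' ∈ Γ)
      (h : u * γ = u' * γ') (hγΔ : γ ∈ Δ) : γ' ∈ Δ := by
    have h1 : γ' * γ⁻¹ ∈ Δ := by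
      refine Subgroup.subset_closure ⟨⟨u'⁻¹, Set.inv_mem_inv.2 (hUK hu'), u, hUK hu, ?_⟩,
        mul_mem hγ' (inv_mem hγ)⟩
      have : u = u' * γ' * γ⁻¹ := by rw [← h]; group
      simp only [this]
      group
    simpa using mul_mem h1 hγΔ
  have hopen (S : Set G) : IsOpen (U * S) := hU.mul_right
  have hclopen : IsClopen (U * (Δ : Set G)) := by
    refine ⟨?_, hopen _⟩
    have : (U * (Δ : Set G))ᶜ = U * ((Γ : Set G) \ Δ) := by
      ext g
      constructor
      · intro hg
        obtain ⟨u, hu, γ, hγ, rfl⟩ := hcov g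
        exact ⟨u, hu, γ, ⟨hγ, fun h => hg ⟨u, hu, γ, h, rfl⟩⟩, rfl⟩
      · rintro ⟨u, hu, γ, ⟨hγ, hγΔ⟩, rfl⟩ ⟨u', hu', γ', hγ', h⟩
        exact hγΔ (hkey hu' hu (hΔΓ hγ') hγ h hγ')
    rw [← isOpen_compl_iff, this]
    exact hopen _
  intro γ hγ
  obtain ⟨u, hu, γ', hγ', h⟩ := hcov 1
  have hne : (U * (Δ : Set G)).Nonempty := ⟨u * 1, u, hu, 1, one_mem _, rfl⟩
  have huniv := IsClopen.eq_univ hclopen hne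
  obtain ⟨v, hv, δ, hδ, hvδ⟩ : u * γ ∈ U * (Δ : Set G) := huniv ▸ Set.mem_univ _
  exact hkey hv hu (hΔΓ hδ) hγ hvδ hδ

end Cover

/-! ### Algebra of the lower central series. -/

section LowerCentralSeries

variable {G : Type*} [Group G]

/-- The elements commuting with `g` modulo the normal subgroup `N`. -/
def centralizerMod (N : Subgroup G) [N.Normal] (g : G) : Subgroup G :=
  (Subgroup.centralizer {QuotientGroup.mk' N g}).comap (QuotientGroup.mk' N)

theorem mem_centralizerMod {N : Subgroup G} [N.Normal] {g y : G} :
    y ∈ centralizerMod N g ↔ ⁅y, g⁆ ∈ N := by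
  rw [centralizerMod, Subgroup.mem_comap, Subgroup.mem_centralizer_singleton_iff,
    ← (QuotientGroup.eq_one_iff (N := N) ⁅y, g⁆), ← commutatorElement_eq_one_iff_mul_comm,
    ← map_commutatorElement]
  rfl

theorem commutator_mem_comm {N : Subgroup G} {y g : G} : ⁅y, g⁆ ∈ N ↔ ⁅g, y⁆ ∈ N := by
  rw [← commutatorElement_inv, inv_mem_iff]

theorem normal_sup_of_commutator_le {H N C : Subgroup G} (hH : H ≤ C) (hN : N ≤ C)
    (hCN : ⁅C, ⊤⁆ ≤ N) : (H ⊔ N).Normal := by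
  refine ⟨fun n hn g => ?_⟩
  have h1 : ⁅n, g⁆ ∈ N := hCN (Subgroup.commutator_mem_commutator (sup_le hH hN hn)
    (Subgroup.mem_top g))
  have h2 : g * n * g⁻¹ = ⁅g, n⁆ * n := by simp [commutatorElement_def]
  rw [h2]
  exact mul_mem (Subgroup.mem_sup_right (commutator_mem_comm.1 h1)) hn

variable (G) in
/-- Shorthand for the lower central series of the whole group. -/
abbrev lcs (i : ℕ) : Subgroup G := (⊤ : Subgroup G).lowerCentralSeries i

theorem lcs_succ_le (i : ℕ) : lcs G (i + 1) ≤ lcs G i :=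
  Subgroup.lowerCentralSeries_antitone _ (Nat.le_succ i)

/-- Modulo `lcs G (i + 2)` commutators of `lcs G i` with `G` are central, so commutators of
generators generate at the next level. Centralizers modulo `N` extend this from generators to whole
subgroups, one argument at a time. -/
theorem exists_finite_lowerCentralSeries_le (Γ : Subgroup G) {F₀ : Set G} (hF₀ : F₀.Finite)
    (hΓ : Subgroup.closure F₀ = Γ) (i : ℕ) :
    ∃ F : Set G, F.Finite ∧ F ⊆ Γ.lowerCentralSeries i ∧
      Γ.lowerCentralSeries i ≤ Subgroup.closure F ⊔ lcs G (i + 1) := by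
  induction i with
  | zero => exact ⟨F₀, hF₀, by rw [Γ.lowerCentralSeries_zero, ← hΓ]; exact Subgroup.subset_closure,
      by rw [Γ.lowerCentralSeries_zero, hΓ]; exact le_sup_left⟩
  | succ i ih =>
    obtain ⟨F, hF, hFD, hDF⟩ := ih
    have hFΓ : F₀ ⊆ Γ := hΓ ▸ Subgroup.subset_closure
    have hsub : Set.image2 (fun d γ => ⁅d, γ⁆) F F₀ ⊆ Γ.lowerCentralSeries (i + 1) := by
      rintro _ ⟨d, hd, γ, hγ, rfl⟩
      exact Subgroup.commutator_mem_commutator (hFD hd) (hFΓ hγ)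
    refine ⟨Set.image2 (fun d γ => ⁅d, γ⁆) F F₀, hF.image2 _ hF₀, hsub, ?_⟩
    set N := Subgroup.closure (Set.image2 (fun d γ => ⁅d, γ⁆) F F₀) ⊔ lcs G (i + 1 + 1) with hN
    have hNn : N.Normal := normal_sup_of_commutator_le (C := lcs G (i + 1))
      (((Subgroup.closure_le _).2 hsub).trans (Subgroup.lowerCentralSeries_mono _ le_top))
      (lcs_succ_le _) le_rfl
    have h1 {γ : G} (hγ : γ ∈ F₀) : Γ.lowerCentralSeries i ≤ centralizerMod N γ := by
      refine hDF.trans (sup_le ((Subgroup.closure_le _).2 fun d hd => ?_) fun c hc => ?_)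
      · exact mem_centralizerMod.2 (Subgroup.mem_sup_left (Subgroup.subset_closure ⟨d, hd, γ, hγ, rfl⟩))
      · exact mem_centralizerMod.2 (Subgroup.mem_sup_right
          (Subgroup.commutator_mem_commutator hc (Subgroup.mem_top _)))
    rw [Subgroup.lowerCentralSeries_succ, Subgroup.commutator_le]
    intro d hd γ hγ
    have h2 : Γ ≤ centralizerMod N d := by
      rw [← hΓ, Subgroup.closure_le]
      exact fun γ hγ => mem_centralizerMod.2 (commutator_mem_comm.1 (mem_centralizerMod.1 (h1 hγ hd)))
    exact commutator_mem_comm.1 (mem_centralizerMod.1 (h2 hγ))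

/-- Three subgroups lemma in the quotient by the target term. The index is shifted because `lcs G 0`
is the whole group. -/
theorem commutator_lcs_le (i j : ℕ) : ⁅lcs G i, lcs G j⁆ ≤ lcs G (i + j + 1) := by
  induction j generalizing i with
  | zero => exact le_rfl
  | succ j ih =>
    set N := lcs G (i + (j + 1) + 1) with hN
    have hmap {A B C : Subgroup G} (h : ⁅⁅A, B⁆, C⁆ ≤ N) :
        ⁅⁅A.map (QuotientGroup.mk' N), B.map (QuotientGroup.mk' N)⁆, C.map (QuotientGroup.mk' N)⁆ = ⊥ := by
      rw [← Subgroup.map_commutator, ← Subgroup.map_commutator, Subgroup.map_eq_bot_iff,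
        QuotientGroup.ker_mk']
      exact h
    have h1 : ⁅⁅(⊤ : Subgroup G), lcs G i⁆, lcs G j⁆ ≤ N := by
      rw [Subgroup.commutator_comm ⊤]
      refine (ih (i + 1)).trans_eq ?_
      rw [hN]; congr 1; ring
    have h2 : ⁅⁅lcs G i, lcs G j⁆, (⊤ : Subgroup G)⁆ ≤ N :=
      (Subgroup.commutator_mono (ih i) le_rfl).trans_eq rfl
    have h3 := Subgroup.commutator_commutator_eq_bot_of_rotate (hmap h1) (hmap h2)
    rw [← Subgroup.map_commutator, ← Subgroup.map_commutator, Subgroup.map_eq_bot_iff,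
      QuotientGroup.ker_mk'] at h3
    rw [Subgroup.commutator_comm]
    exact h3

end LowerCentralSeries

/-! ### Cocompactness of the lattice in the lower central series. -/

section Cocompact

open Filter Topology Pointwise

variable {G : Type*} [Group G] [TopologicalSpace G] [IsTopologicalGroup G]

/-- In a connected, locally compact nilpotent group generated by elements with vanishing roots, a
discrete cocompact subgroup meets each term of the lower central series in a cocompact subgroup. -/
theorem exists_compact_lcs_subset [LocallyCompactSpace G] [T2Space G] [PreconnectedSpace G]
    (hroots : Subgroup.closure {y : G | HasVanishingRoots y} = ⊤)
    (Γ : Subgroup G) [DiscreteTopology Γ] [CompactSpace (G ⧸ Γ)] {s : ℕ} (hs : lcs G s = ⊥)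
    (i : ℕ) :
    ∃ K : Set G, IsCompact K ∧ K ⊆ lcs G i ∧
      (lcs G i : Set G) ⊆ K * (Γ.lowerCentralSeries i : Set G) := by
  obtain ⟨U, K₀, -, hK₀, hUK, hcov⟩ := exists_isOpen_isCompact_cover Γ
  replace hcov (g) : ∃ k ∈ K₀, ∃ γ ∈ Γ, g = k * γ := by
    obtain ⟨u, hu, h⟩ := hcov g
    exact ⟨u, hUK hu, h⟩
  obtain ⟨F₀, hF₀, hF₀Γ⟩ := exists_finite_closure_eq Γ
  have hDC (i) : Γ.lowerCentralSeries i ≤ lcs G i := Subgroup.lowerCentralSeries_mono i le_top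
  -- Ascending induction gives cocompactness only modulo the next term and up to closure; the
  -- descending induction `main` then removes both defects.
  have hup (i : ℕ) : ∃ K : Set G, IsCompact K ∧ K ⊆ lcs G i ∧
      (lcs G i : Set G) ⊆
        K * ((Γ.lowerCentralSeries i ⊔ lcs G (i + 1)).topologicalClosure : Set G) := by
    induction i with
    | zero =>
      refine ⟨K₀, hK₀, fun _ _ => Subgroup.mem_top _, fun g _ => ?_⟩
      obtain ⟨k, hk, γ, hγ, rfl⟩ := hcov g
      exact ⟨k, hk, γ, Subgroup.le_topologicalClosure _ (Subgroup.mem_sup_left hγ), rfl⟩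
    | succ i ih =>
      obtain ⟨K, hK, -, hCK⟩ := ih
      obtain ⟨F, hF, hFD, hDF⟩ := exists_finite_lowerCentralSeries_le Γ hF₀ hF₀Γ i
      set S := Γ.lowerCentralSeries (i + 1) ⊔ lcs G (i + 1 + 1) with hS
      have hSn : S.Normal := normal_sup_of_commutator_le (hDC _) (lcs_succ_le _) le_rfl
      have hTn : S.topologicalClosure.Normal := Subgroup.is_normal_topologicalClosure S
      exact exists_compact_commutator_subset hroots hK₀ hcov (C := lcs G i) (C' := lcs G (i + 1))
        (D := Γ.lowerCentralSeries i) (T := S.topologicalClosure)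
        S.isClosed_topologicalClosure le_rfl
        (le_sup_right.trans S.le_topologicalClosure) (hDC i)
        (le_sup_left.trans S.le_topologicalClosure) hF hFD hDF hK hCK
  have hclosed (i) : IsClosed (Γ.lowerCentralSeries i : Set G) := by
    have hd : DiscreteTopology (Γ.lowerCentralSeries i) := DiscreteTopology.of_subset
      (s := (Γ : Set G)) ‹_› (Γ.lowerCentralSeries_le_self i)
    exact Subgroup.isClosed_of_discrete
  have hbot {j : ℕ} (hj : s ≤ j) : lcs G j = ⊥ :=
    le_bot_iff.1 (hs ▸ Subgroup.lowerCentralSeries_antitone _ hj)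
  have main (n : ℕ) : ∀ i, s ≤ i + n → ∃ K : Set G, IsCompact K ∧ K ⊆ lcs G i ∧
      (lcs G i : Set G) ⊆ K * (Γ.lowerCentralSeries i : Set G) := by
    induction n with
    | zero =>
      intro i hi
      refine ⟨{1}, isCompact_singleton, by simp, ?_⟩
      rw [hbot (j := i) hi]
      rintro _ rfl
      exact ⟨1, rfl, 1, one_mem _, by simp⟩
    | succ n ih =>
      intro i hi
      obtain ⟨K', hK', hK'C, hCK'⟩ := ih (i + 1) (by omega)
      obtain ⟨K, hK, hKC, hCK⟩ := hup i
      refine ⟨K * K', hK.mul hK', ?_, ?_⟩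
      · rintro _ ⟨k, hk, k', hk', rfl⟩
        exact mul_mem (hKC hk) (lcs_succ_le _ (hK'C hk'))
      · have h1 : ((Γ.lowerCentralSeries i ⊔ lcs G (i + 1)).topologicalClosure : Set G) ⊆
            K' * (Γ.lowerCentralSeries i : Set G) := by
          -- A compact set times the closed discrete `Γ.lowerCentralSeries i` is closed, so the
          -- closure adds nothing.
          refine closure_minimal ?_ ((hclosed i).mul_left_of_isCompact hK')
          rw [sup_comm, Subgroup.normal_mul]
          rintro _ ⟨c, hc, d, hd, rfl⟩
          obtain ⟨k, hk, d', hd', rfl⟩ := hCK' hc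
          exact ⟨k, hk, d' * d, mul_mem (Γ.lowerCentralSeries_antitone (Nat.le_succ i) hd') hd,
            by simp [mul_assoc]⟩
        refine hCK.trans ?_
        rw [mul_assoc]
        exact Set.mul_subset_mul_left h1
  exact main s i (by omega)

end Cocompact

/-! ### Filtrations and Host–Kra cube groups. -/

/-- A filtration of subgroups `H 0 ≥ H 1 ≥ ⋯` with `⁅H i, H j⁆ ≤ H (i + j)`. -/
structure GroupFiltration (A : Type*) [Group A] where
  toFun : ℕ → Subgroup A
  succ_le : ∀ i, toFun (i + 1) ≤ toFun i
  commutator_le : ∀ i j, ⁅toFun i, toFun j⁆ ≤ toFun (i + j)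

namespace GroupFiltration

variable {A B : Type*} [Group A] [Group B] (H : GroupFiltration A)

theorem antitone : Antitone H.toFun := antitone_nat_of_succ_le H.succ_le

theorem le_zero (i : ℕ) : H.toFun i ≤ H.toFun 0 := H.antitone (Nat.zero_le i)

theorem commutator_mem {i j : ℕ} {a b : A} (ha : a ∈ H.toFun i) (hb : b ∈ H.toFun j) :
    ⁅a, b⁆ ∈ H.toFun (i + j) :=
  H.commutator_le i j (Subgroup.commutator_mem_commutator ha hb)

theorem conj_mem {j : ℕ} {a x : A} (ha : a ∈ H.toFun 0) (hx : x ∈ H.toFun j) :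
    a * x * a⁻¹ ∈ H.toFun j := by
  have h : a * x * a⁻¹ = ⁅a, x⁆ * x := by simp [commutatorElement_def]
  rw [h]
  exact mul_mem (by simpa using H.commutator_mem ha hx) hx

theorem conj_mem' {j : ℕ} {a x : A} (ha : a ∈ H.toFun 0) (hx : x ∈ H.toFun j) :
    a⁻¹ * x * a ∈ H.toFun j := by
  simpa using H.conj_mem (inv_mem ha) hx

/-- The pull-back of a filtration. -/
def comap (f : B →* A) : GroupFiltration B where
  toFun i := (H.toFun i).comap f
  succ_le i := Subgroup.comap_mono (H.succ_le i)
  commutator_le i j := by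
    rw [Subgroup.commutator_le]
    intro a ha b hb
    rw [Subgroup.mem_comap, map_commutatorElement]
    exact H.commutator_mem ha hb

/-- The filtration of pairs `(a, b)` with `a ∈ H i` and `a⁻¹ b ∈ H (i + 1)`. -/
def double : GroupFiltration (A × A) where
  toFun i :=
    { carrier := {p | p.1 ∈ H.toFun i ∧ p.1⁻¹ * p.2 ∈ H.toFun (i + 1)}
      one_mem' := by simp
      mul_mem' := by
        rintro ⟨a, b⟩ ⟨a', b'⟩ ⟨h1, h2⟩ ⟨h3, h4⟩
        refine ⟨mul_mem h1 h3, ?_⟩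
        have h := mul_mem (H.conj_mem' (H.le_zero _ h3) h2) h4
        simpa [mul_assoc] using h
      inv_mem' := by
        rintro ⟨a, b⟩ ⟨h1, h2⟩
        refine ⟨inv_mem h1, ?_⟩
        have h := H.conj_mem (H.le_zero _ h1) (inv_mem h2)
        simpa [mul_assoc] using h }
  succ_le i := fun _ hp => ⟨H.succ_le _ hp.1, H.succ_le _ hp.2⟩
  commutator_le i j := by
    rw [Subgroup.commutator_le]
    rintro ⟨a, c⟩ ⟨h1, h2⟩ ⟨b, f⟩ ⟨h3, h4⟩
    have hab : ⁅a, b⁆ ∈ H.toFun (i + j) := H.commutator_mem h1 h3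
    refine ⟨hab, ?_⟩
    change ⁅a, b⁆⁻¹ * ⁅c, f⁆ ∈ H.toFun (i + j + 1)
    -- With `c = a * d` and `f = b * e`, expanding `⁅a * d, b * e⁆` leaves, besides `⁅a, b⁆`,
    -- conjugates of `⁅d, b * e⁆` and `⁅a, e⁆`, both of degree `i + j + 1`.
    obtain ⟨d, rfl⟩ : ∃ d, c = a * d := ⟨a⁻¹ * c, by group⟩
    obtain ⟨e, rfl⟩ : ∃ e, f = b * e := ⟨b⁻¹ * f, by group⟩
    simp only [inv_mul_cancel_left] at h2 h4
    have n1 : a * ⁅d, b * e⁆ * a⁻¹ ∈ H.toFun (i + j + 1) := by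
      refine H.conj_mem (H.le_zero _ h1) ?_
      have := H.commutator_mem h2 (mul_mem h3 (H.succ_le _ h4))
      rwa [add_right_comm] at this
    have n2 : b * ⁅a, e⁆ * b⁻¹ ∈ H.toFun (i + j + 1) :=
      H.conj_mem (H.le_zero _ h3) (show ⁅a, e⁆ ∈ H.toFun (i + (j + 1)) from H.commutator_mem h1 h4)
    have h := mul_mem (H.conj_mem' (H.le_zero _ hab) n1) n2
    rw [commutatorElement_mul_left_eq_conj_mul, commutatorElement_mul_right_eq_mul_conj a b e]
    simpa [mul_assoc] using h

/-- The two opposite faces of a cube, in the direction of the first coordinate. -/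
def facesHom (G : Type*) [Group G] (k : ℕ) :
    ((Fin (k + 1) → Bool) → G) →* ((Fin k → Bool) → G) × ((Fin k → Bool) → G) where
  toFun c := (fun v => c (Fin.cons false v), fun v => c (Fin.cons true v))
  map_one' := rfl
  map_mul' _ _ := rfl

/-- The Host–Kra cube groups of a filtered group, as a filtration on `G^{2^k}`. -/
def cube : ∀ k : ℕ, GroupFiltration ((Fin k → Bool) → A)
  | 0 => H.comap (Pi.evalMonoidHom _ fun _ => false)
  | k + 1 => (cube k).double.comap (facesHom A k)

theorem mem_cube_zero {i : ℕ} {c : (Fin 0 → Bool) → A} :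
    c ∈ (H.cube 0).toFun i ↔ c (fun _ => false) ∈ H.toFun i := Iff.rfl

theorem mem_cube_succ {k i : ℕ} {c : (Fin (k + 1) → Bool) → A} :
    c ∈ (H.cube (k + 1)).toFun i ↔ (fun v => c (Fin.cons false v)) ∈ (H.cube k).toFun i ∧
      (fun v => (c (Fin.cons false v))⁻¹ * c (Fin.cons true v)) ∈ (H.cube k).toFun (i + 1) := Iff.rfl

theorem const_mem_cube {k i : ℕ} {a : A} (ha : a ∈ H.toFun i) :
    (fun _ => a) ∈ (H.cube k).toFun i := by
  induction k with
  | zero => exact H.mem_cube_zero.2 ha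
  | succ k ih =>
    refine H.mem_cube_succ.2 ⟨ih, ?_⟩
    simp only [inv_mul_cancel]
    exact one_mem _

/-- The quotient of opposite faces is the constant cube `g ^ h 0`, which has degree `1` because `g`
does. -/
theorem zpow_mem_cube {k : ℕ} {g : A} (hg : g ∈ H.toFun 1) (h : Fin k → ℤ) :
    (fun v : Fin k → Bool => g ^ ∑ j, if v j then h j else 0) ∈ (H.cube k).toFun 0 := by
  induction k with
  | zero => exact H.mem_cube_zero.2 (by simp)
  | succ k ih =>
    rw [mem_cube_succ]
    simp only [Fin.sum_univ_succ, Fin.cons_zero, Fin.cons_succ, Bool.false_eq_true, if_false,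
      zero_add, if_true]
    refine ⟨ih _, ?_⟩
    have : (fun v : Fin k → Bool => (g ^ ∑ j, if v j then h j.succ else 0)⁻¹ *
        g ^ (h 0 + ∑ j, if v j then h j.succ else 0)) = fun _ => g ^ h 0 := by
      ext v
      rw [add_comm, zpow_add, inv_mul_cancel_left]
    rw [this]
    exact H.const_mem_cube (zpow_mem hg _)

/-- The last vertex of a cube lies in `Λ` as soon as all the other vertices do. -/
theorem cube_top_mem {Λ : Subgroup A} {k i : ℕ} (hH : H.toFun (i + k) ≤ Λ)
    {c : (Fin k → Bool) → A} (hc : c ∈ (H.cube k).toFun i)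
    (hcΛ : ∀ v, v ≠ (fun _ => true) → c v ∈ Λ) : c (fun _ => true) ∈ Λ := by
  induction k generalizing i with
  | zero =>
    rw [Subsingleton.elim (fun _ => true : Fin 0 → Bool) fun _ => false]
    exact hH (H.mem_cube_zero.1 hc)
  | succ k ih =>
    have hft (v : Fin k → Bool) : (Fin.cons false v : Fin (k + 1) → Bool) ≠ fun _ => true :=
      fun h => by simpa using congr_fun h 0
    have htop : (Fin.cons true (fun _ => true) : Fin (k + 1) → Bool) = fun _ => true := by
      ext j; refine Fin.cases ?_ (fun _ => ?_) j <;> simp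
    -- The quotient of opposite faces trades one dimension for one degree, which keeps `i + k`
    -- fixed.
    have h := ih (i := i + 1) (by rwa [add_right_comm]) (H.mem_cube_succ.1 hc).2 fun v hv =>
      mul_mem (inv_mem (hcΛ _ (hft v))) (hcΛ _ fun h => hv (by
        rw [← htop] at h
        exact Fin.cons_right_injective _ h))
    have h' := mul_mem (hcΛ _ (hft fun _ => true)) h
    rwa [mul_inv_cancel_left, htop] at h'

open Pointwise

variable [TopologicalSpace A] [TopologicalSpace B]

/-- `Λ` meets all the terms of the filtration in cocompact subgroups. -/
def IsCocompact (Λ : Subgroup A) : Prop :=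
  ∀ i, ∃ K : Set A, IsCompact K ∧ K ⊆ (H.toFun i : Set A) ∧
    ∀ a ∈ H.toFun i, ∃ x ∈ K, x⁻¹ * a ∈ Λ

variable {H}

theorem IsCocompact.comap {Λ : Subgroup A} (h : H.IsCocompact Λ) (f : B →* A) {σ : A → B}
    (hσ : Continuous σ) (hf : ∀ a, f (σ a) = a) : (H.comap f).IsCocompact (Λ.comap f) := by
  intro i
  obtain ⟨K, hK, hKH, hcov⟩ := h i
  refine ⟨σ '' K, hK.image hσ, ?_, fun b hb => ?_⟩
  · rintro _ ⟨x, hx, rfl⟩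
    change f (σ x) ∈ H.toFun i
    rw [hf]
    exact hKH hx
  · obtain ⟨x, hx, hxΛ⟩ := hcov (f b) hb
    refine ⟨_, ⟨x, hx, rfl⟩, ?_⟩
    rw [Subgroup.mem_comap, map_mul, map_inv, hf]
    exact hxΛ

/-- Correct `a` by `x`, then apply cocompactness one degree deeper to `a⁻¹ * b` conjugated by `x⁻¹ *
a ∈ Λ`; the conjugation makes the second correction compatible with the first. -/
theorem IsCocompact.double [IsTopologicalGroup A] {Λ : Subgroup A} (h : H.IsCocompact Λ) :
    H.double.IsCocompact (Λ.prod Λ) := by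
  intro i
  obtain ⟨K, hK, hKH, hcov⟩ := h i
  obtain ⟨K', hK', hKH', hcov'⟩ := h (i + 1)
  refine ⟨(fun p : A × A => (p.1, p.1 * p.2)) '' (K ×ˢ K'), (hK.prod hK').image (by fun_prop), ?_, ?_⟩
  · rintro _ ⟨⟨x, y⟩, ⟨hx, hy⟩, rfl⟩
    refine ⟨hKH hx, ?_⟩
    simpa using hKH' hy
  · rintro ⟨a, b⟩ ⟨ha, hb⟩
    obtain ⟨x, hx, hxΛ⟩ := hcov a ha
    have hxa : x⁻¹ * a ∈ H.toFun 0 := H.le_zero i (mul_mem (inv_mem (hKH hx)) ha)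
    obtain ⟨y, hy, hyΛ⟩ := hcov' _ (H.conj_mem hxa hb)
    refine ⟨_, ⟨(x, y), ⟨hx, hy⟩, rfl⟩, hxΛ, ?_⟩
    have := mul_mem hyΛ hxΛ
    change (x * y)⁻¹ * b ∈ Λ
    simpa [mul_assoc] using this

theorem IsCocompact.cube [IsTopologicalGroup A] {Λ : Subgroup A} (h : H.IsCocompact Λ) (k : ℕ) :
    (H.cube k).IsCocompact (Subgroup.pi Set.univ fun _ => Λ) := by
  induction k with
  | zero =>
    have := h.comap (Pi.evalMonoidHom (fun _ : Fin 0 → Bool => A) fun _ => false)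
      (σ := fun a _ => a) (by fun_prop) fun _ => rfl
    convert! this using 1
    ext c
    simp only [Subgroup.mem_pi, Set.mem_univ, true_imp_iff, Subgroup.mem_comap]
    exact ⟨fun h => h _, fun h v => by rwa [Subsingleton.elim v fun _ => false]⟩
  | succ k ih =>
    have := ih.double.comap (facesHom A k)
      (σ := fun p v => if v 0 then p.2 (Fin.tail v) else p.1 (Fin.tail v)) (by
        refine continuous_pi fun v => ?_
        split_ifs <;> fun_prop) (fun p => by
        ext v <;> simp [facesHom])
    convert! this using 1
    ext c
    simp only [Subgroup.mem_pi, Set.mem_univ, true_imp_iff, Subgroup.mem_comap, Subgroup.mem_prod]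
    refine ⟨fun h => ⟨fun v => h _, fun v => h _⟩, fun h v => ?_⟩
    rw [← Fin.cons_self_tail v]
    cases v 0
    · exact h.1 _
    · exact h.2 _

end GroupFiltration

/-- The lower central series, indexed so that the terms `0` and `1` are the whole group. -/
def lcsFiltration (G : Type*) [Group G] : GroupFiltration G where
  toFun i := lcs G (i - 1)
  succ_le i := Subgroup.lowerCentralSeries_antitone _ (by omega)
  commutator_le i j := (commutator_lcs_le _ _).trans
    (Subgroup.lowerCentralSeries_antitone _ (by omega))

/-! ### The compact set of cubes on the nilmanifold. -/

section CubePoints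

open Pointwise

variable {G : Type*} [Group G] [TopologicalSpace G] [IsTopologicalGroup G]

/-- In an `s`-step nilmanifold, the `(s+1)`-dimensional parallelepipeds along orbits lie in a compact
set of cubes whose last vertex is determined by the other ones. -/
theorem exists_isCompact_cubes [LocallyCompactSpace G] [T2Space G] [PreconnectedSpace G]
    (hroots : Subgroup.closure {y : G | HasVanishingRoots y} = ⊤)
    (Γ : Subgroup G) [DiscreteTopology Γ] [CompactSpace (G ⧸ Γ)] {s : ℕ} (hs : lcs G s = ⊥) :
    ∃ P : Set ((Fin (s + 1) → Bool) → G ⧸ Γ), IsCompact P ∧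
      (∀ (g : G) (x : G ⧸ Γ) (m : ℤ) (h : Fin (s + 1) → ℤ),
        (fun v => g ^ (m + ∑ j, if v j then h j else 0) • x) ∈ P) ∧
      ∀ p ∈ P, ∀ q ∈ P, (∀ v, v ≠ (fun _ => true) → p v = q v) →
        p (fun _ => true) = q (fun _ => true) := by
  set H := lcsFiltration G with hH
  have hcoc : H.IsCocompact Γ := by
    intro i
    obtain ⟨K, hK, hKC, hcov⟩ := exists_compact_lcs_subset hroots Γ hs (i - 1)
    refine ⟨K, hK, hKC, fun a ha => ?_⟩
    obtain ⟨k, hk, d, hd, rfl⟩ := hcov ha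
    exact ⟨k, hk, by simpa using Γ.lowerCentralSeries_le_self _ hd⟩
  obtain ⟨K, hK, hKH, hcov⟩ := hcoc.cube (s + 1) 0
  refine ⟨(fun c v => (c v : G ⧸ Γ)) '' K, hK.image ?_, ?_, ?_⟩
  · exact continuous_pi fun v => QuotientGroup.continuous_mk.comp (continuous_apply v)
  · intro g x m h
    obtain ⟨a, rfl⟩ := QuotientGroup.mk_surjective x
    have hc : (fun v : Fin (s + 1) → Bool => g ^ (m + ∑ j, if v j then h j else 0) * a) ∈
        (H.cube (s + 1)).toFun 0 := by
      have h1 := mul_mem (mul_mem (H.const_mem_cube (k := s + 1) (i := 0) (a := g ^ m)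
        (Subgroup.mem_top _)) (H.zpow_mem_cube (g := g) (Subgroup.mem_top _) h))
        (H.const_mem_cube (k := s + 1) (i := 0) (a := a) (Subgroup.mem_top _))
      convert h1 using 1
      ext v
      simp [zpow_add]
    obtain ⟨x, hx, hxΛ⟩ := hcov _ hc
    refine ⟨x, hx, ?_⟩
    ext v
    exact QuotientGroup.eq.2 ((Subgroup.mem_pi _).1 hxΛ v (Set.mem_univ v))
  · rintro _ ⟨c, hc, rfl⟩ _ ⟨c', hc', rfl⟩ h
    refine QuotientGroup.eq.2 (H.cube_top_mem (Λ := Γ) (k := s + 1) (i := 0) (c := c⁻¹ * c') ?_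
      (mul_mem (inv_mem (hKH hc)) (hKH hc')) fun v hv => QuotientGroup.eq.1 (h v hv))
    -- Degree `s + 1` of the filtration is `lcs G s`, which is trivial: this is why cubes of
    -- dimension `s + 1` are used.
    change lcs G (0 + (s + 1) - 1) ≤ Γ
    rw [show 0 + (s + 1) - 1 = s by omega, hs]
    exact bot_le

end CubePoints

end Commutators

/-! ### Lipschitz functions, Stone–Weierstrass approximation and finite nets. -/

section LipschitzFunctions

/-- `F` is Lipschitz, for some constant, with respect to the distance function `d`. -/
def HasLipschitzBound {Y : Type*} (d : Y → Y → ℝ≥0∞) (F : Y → ℝ) : Prop :=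
  ∃ L : ℝ, 0 ≤ L ∧ ∀ x y, ENNReal.ofReal |F x - F y| ≤ ENNReal.ofReal L * d x y

namespace HasLipschitzBound

variable {Y : Type*} {d : Y → Y → ℝ≥0∞} {F F' : Y → ℝ}

theorem const (c : ℝ) : HasLipschitzBound d fun _ => c := ⟨0, le_rfl, by simp⟩

theorem add (h : HasLipschitzBound d F) (h' : HasLipschitzBound d F') :
    HasLipschitzBound d fun x => F x + F' x := by
  obtain ⟨L, hL, h⟩ := h
  obtain ⟨L', hL', h'⟩ := h'
  refine ⟨L + L', add_nonneg hL hL', fun x y => ?_⟩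
  rw [ENNReal.ofReal_add hL hL', add_mul]
  refine le_trans ?_ (add_le_add (h x y) (h' x y))
  rw [← ENNReal.ofReal_add (abs_nonneg _) (abs_nonneg _)]
  refine ENNReal.ofReal_le_ofReal ?_
  rw [show F x + F' x - (F y + F' y) = (F x - F y) + (F' x - F' y) by ring]
  exact abs_add_le _ _

theorem mul (h : HasLipschitzBound d F) (h' : HasLipschitzBound d F') {B B' : ℝ}
    (hB : ∀ x, |F x| ≤ B) (hB' : ∀ x, |F' x| ≤ B') :
    HasLipschitzBound d fun x => F x * F' x := by
  obtain ⟨L, hL, h⟩ := h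
  obtain ⟨L', hL', h'⟩ := h'
  refine ⟨|B| * L' + |B'| * L, by positivity, fun x y => ?_⟩
  rw [ENNReal.ofReal_add (by positivity) (by positivity), add_mul,
    ENNReal.ofReal_mul (abs_nonneg _), ENNReal.ofReal_mul (abs_nonneg _), mul_assoc, mul_assoc]
  refine le_trans ?_ (add_le_add (mul_le_mul_right (h' x y) _) (mul_le_mul_right (h x y) _))
  rw [← ENNReal.ofReal_mul (abs_nonneg _), ← ENNReal.ofReal_mul (abs_nonneg _),
    ← ENNReal.ofReal_add (by positivity) (by positivity)]
  refine ENNReal.ofReal_le_ofReal ?_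
  rw [show F x * F' x - F y * F' y = F x * (F' x - F' y) + F' y * (F x - F y) by ring]
  refine (abs_add_le _ _).trans ?_
  rw [abs_mul, abs_mul]
  exact add_le_add
    (mul_le_mul_of_nonneg_right ((hB x).trans (le_abs_self _)) (abs_nonneg _))
    (mul_le_mul_of_nonneg_right ((hB' y).trans (le_abs_self _)) (abs_nonneg _))

theorem const_mul (c : ℝ) (h : HasLipschitzBound d F) : HasLipschitzBound d fun x => c * F x := by
  obtain ⟨L, hL, h⟩ := h
  refine ⟨|c| * L, by positivity, fun x y => ?_⟩
  rw [← mul_sub, abs_mul, ENNReal.ofReal_mul (abs_nonneg _), ENNReal.ofReal_mul (abs_nonneg _),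
    mul_assoc]
  exact mul_le_mul_right (h x y) _

end HasLipschitzBound

theorem edist_le_productEDist {X : Type*} {k : ℕ} (d : X → X → ℝ≥0∞) (x y : Fin k → X) (i : Fin k) :
    d (x i) (y i) ≤ productEDist k d x y := by
  have h : d (x i) (y i) ^ 2 ≤ ∑ j, d (x j) (y j) ^ 2 :=
    Finset.single_le_sum (f := fun j => d (x j) (y j) ^ 2) (fun _ _ => zero_le) (Finset.mem_univ i)
  have h2 := ENNReal.rpow_le_rpow h (by norm_num : (0 : ℝ) ≤ 1 / 2)
  rwa [← ENNReal.rpow_natCast, ← ENNReal.rpow_mul, show ((2 : ℕ) : ℝ) * (1 / 2) = 1 by norm_num,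
    ENNReal.rpow_one] at h2

variable {X : Type*} [EMetricSpace X]

/-- The distance to `a`, truncated at `1`. -/
noncomputable def truncDist (a x : X) : ℝ := (min (edist x a) 1).toReal

theorem truncDist_mem_Icc (a x : X) : truncDist a x ∈ Set.Icc (0 : ℝ) 1 :=
  ⟨ENNReal.toReal_nonneg, ENNReal.toReal_le_of_le_ofReal zero_le_one (by simp)⟩

theorem ofReal_abs_truncDist_sub_le (a x y : X) :
    ENNReal.ofReal |truncDist a x - truncDist a y| ≤ edist x y := by
  have hfin (x : X) : min (edist x a) 1 ≠ ⊤ := ((min_le_right _ _).trans_lt ENNReal.one_lt_top).ne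
  by_cases h : edist x y = ⊤
  · simp [h]
  have key (x y : X) (h : edist x y ≠ ⊤) :
      truncDist a x - truncDist a y ≤ (edist x y).toReal := by
    rw [sub_le_iff_le_add, truncDist, truncDist, ← ENNReal.toReal_add h (hfin y)]
    refine ENNReal.toReal_mono (ENNReal.add_ne_top.2 ⟨h, hfin y⟩) ?_
    rw [add_min]
    refine le_min ((min_le_left _ _).trans (edist_triangle _ _ _))
      ((min_le_right _ _).trans le_add_self)
  rw [← ENNReal.ofReal_toReal h]
  refine ENNReal.ofReal_le_ofReal (abs_sub_le_iff.2 ⟨key x y h, ?_⟩)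
  rw [edist_comm] at h ⊢
  exact key y x h

theorem continuous_truncDist (a : X) : Continuous (truncDist a) := by
  have : LipschitzWith 1 (truncDist a) := fun x y => by
    rw [edist_dist, Real.dist_eq, ENNReal.coe_one, one_mul]
    exact ofReal_abs_truncDist_sub_le a x y
  exact this.continuous

theorem truncDist_ne {a x : X} (h : x ≠ a) : truncDist a x ≠ truncDist a a := by
  have h1 : truncDist a a = 0 := by simp [truncDist]
  rw [h1, truncDist, ENNReal.toReal_ne_zero]
  refine ⟨?_, ((min_le_right _ _).trans_lt ENNReal.one_lt_top).ne⟩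
  have : 0 < edist x a := edist_pos.2 h
  exact (lt_min this one_pos).ne'

/-- The truncated distance functions in one coordinate, as functions on a power of `X`. -/
noncomputable def coordFun {m : ℕ} (i : Fin m) (a : X) : C(Fin m → X, ℝ) :=
  ⟨fun y => truncDist a (y i), (continuous_truncDist a).comp (continuous_apply i)⟩

/-- `Ψ` is a product of bounded functions of the coordinates. -/
def IsBoundedProduct {m : ℕ} (Ψ : (Fin m → X) → ℝ) : Prop :=
  ∃ φ : Fin m → X → ℝ, (∀ i x, |φ i x| ≤ 1) ∧ ∀ y, Ψ y = ∏ i, φ i (y i)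

/-- The Lipschitz bound serves the constant `L`; the product structure is what the
Gowers–Cauchy–Schwarz bound requires. -/
theorem of_mem_closure_coordFun [CompactSpace X] {m : ℕ} {Ψ : C(Fin m → X, ℝ)}
    (h : Ψ ∈ Submonoid.closure {Ψ : C(Fin m → X, ℝ) | ∃ i a, Ψ = coordFun i a}) :
    HasLipschitzBound (productEDist m edist) Ψ ∧ IsBoundedProduct Ψ := by
  induction h using Submonoid.closure_induction with
  | mem Ψ h =>
    obtain ⟨i, a, rfl⟩ := h
    refine ⟨⟨1, zero_le_one, fun x y => ?_⟩, fun j x => if j = i then truncDist a x else 1, ?_, ?_⟩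
    · rw [ENNReal.ofReal_one, one_mul]
      exact (ofReal_abs_truncDist_sub_le a (x i) (y i)).trans (edist_le_productEDist edist x y i)
    · intro j x
      dsimp only
      split_ifs
      · exact abs_le.2 ⟨by linarith [(truncDist_mem_Icc a x).1], (truncDist_mem_Icc a x).2⟩
      · simp
    · intro y
      simp [coordFun]
  | one => exact ⟨HasLipschitzBound.const 1, fun _ _ => 1, by simp, by simp⟩
  | mul Ψ Ψ' _ _ h h' =>
    refine ⟨h.1.mul h'.1 (fun x => Ψ.norm_coe_le_norm x) fun x => Ψ'.norm_coe_le_norm x, ?_⟩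
    obtain ⟨φ, hφ, hΨ⟩ := h.2
    obtain ⟨φ', hφ', hΨ'⟩ := h'.2
    refine ⟨fun i x => φ i x * φ' i x, fun i x => ?_, fun y => ?_⟩
    · rw [abs_mul]
      exact mul_le_one₀ (hφ i x) (abs_nonneg _) (hφ' i x)
    · rw [ContinuousMap.mul_apply, hΨ, hΨ', Finset.prod_mul_distrib]

theorem separatesPoints_adjoin_coordFun (m : ℕ) :
    (Algebra.adjoin ℝ {Ψ : C(Fin m → X, ℝ) | ∃ i a, Ψ = coordFun i a}).SeparatesPoints := by
  intro x y hxy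
  obtain ⟨i, hi⟩ := Function.ne_iff.1 hxy
  exact ⟨_, ⟨coordFun i (y i), Algebra.subset_adjoin ⟨i, y i, rfl⟩, rfl⟩, truncDist_ne hi⟩

/-- On a compact set of cubes whose last vertex is determined by the others, a continuous function of
the last vertex is approximated by a combination of products of functions of the other vertices. -/
theorem exists_approx_of_isCompact_cubes [CompactSpace X] {V : Type*} {v₀ : V} {m : ℕ}
    (τ : Fin m ≃ {v : V // v ≠ v₀}) {P : Set (V → X)} (hP : IsCompact P)
    (hdet : ∀ p ∈ P, ∀ q ∈ P, (∀ v, v ≠ v₀ → p v = q v) → p v₀ = q v₀)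
    (F : C(X, ℝ)) (hF : ∀ x, F x ∈ Set.Icc (-1 : ℝ) 1) {δ : ℝ} (hδ : 0 < δ) :
    ∃ Ψ ∈ Submodule.span ℝ
        (Submonoid.closure {Ψ : C(Fin m → X, ℝ) | ∃ i a, Ψ = coordFun i a} : Set C(Fin m → X, ℝ)),
      (∀ y, Ψ y ∈ Set.Icc (-1 : ℝ) 1) ∧ ∀ p ∈ P, |Ψ (fun i => p (τ i)) - F (p v₀)| ≤ δ := by
  have : CompactSpace P := isCompact_iff_compactSpace.1 hP
  set e : P → Fin m → X := fun p i => p.1 (τ i) with he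
  have hev (v : V) : Continuous fun p : P => p.1 v :=
    (continuous_apply v).comp continuous_subtype_val
  have hec : Continuous e := continuous_pi fun i => hev _
  -- Forgetting the last vertex is injective on `P`, hence a closed embedding by compactness, so the
  -- Tietze theorem extends `F` of the last vertex to the whole power.
  have hinj : Function.Injective e := by
    intro p q h
    have h1 (v) (hv : v ≠ v₀) : p.1 v = q.1 v := by
      simpa [he] using congr_fun h (τ.symm ⟨v, hv⟩)
    ext v
    by_cases hv : v = v₀
    · rw [hv]
      exact hdet _ p.2 _ q.2 h1
    · exact h1 v hv
  obtain ⟨Φ, hΦ, hΦe⟩ := ContinuousMap.exists_extension_forall_mem_of_isClosedEmbedding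
    (f := (⟨fun p => F (p.1 v₀), F.continuous.comp (hev v₀)⟩ : C(P, ℝ))) (t := Set.Icc (-1 : ℝ) 1)
    (fun p => hF _) ⟨0, by simp⟩ (hec.isClosedEmbedding hinj)
  obtain ⟨⟨Ψ, hΨ⟩, hΨΦ⟩ := ContinuousMap.exists_mem_subalgebra_near_continuousMap_of_separatesPoints
    _ (separatesPoints_adjoin_coordFun m) Φ (δ / 2) (by positivity)
  have hnear (y) : |Ψ y - Φ y| ≤ δ / 2 :=
    ((Ψ - Φ).norm_coe_le_norm y).trans hΨΦ.le
  have hbd (y) : |Ψ y| ≤ 1 + δ / 2 := by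
    have h1 := abs_le.1 (hnear y)
    have h2 := hΦ y
    exact abs_le.2 ⟨by linarith [h1.1, h2.1], by linarith [h1.2, h2.2]⟩
  have hpos : 0 < 1 + δ / 2 := by positivity
  rw [← Subalgebra.mem_toSubmodule, Algebra.adjoin_eq_span] at hΨ
  -- The polynomial approximation may exceed `1` by `δ / 2`; rescaling restores the range `[-1, 1]`
  -- and costs another `δ / 2`.
  refine ⟨(1 + δ / 2)⁻¹ • Ψ, Submodule.smul_mem _ _ hΨ, fun y => ?_, fun p hp => ?_⟩
  · rw [ContinuousMap.smul_apply, smul_eq_mul, Set.mem_Icc, ← abs_le, abs_mul, abs_of_pos (inv_pos.2 hpos),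
      inv_mul_le_iff₀ hpos, mul_one]
    exact hbd y
  · have h1 : Φ (e ⟨p, hp⟩) = F (p v₀) := congr_fun hΦe ⟨p, hp⟩
    change |(1 + δ / 2)⁻¹ * Ψ (e ⟨p, hp⟩) - F (p v₀)| ≤ δ
    rw [← h1]
    set y := e ⟨p, hp⟩
    have h2 : (1 + δ / 2)⁻¹ * Ψ y - Φ y =
        (Ψ y - Φ y) - (δ / 2) * ((1 + δ / 2)⁻¹ * Ψ y) := by field_simp; ring
    have h3 : |(1 + δ / 2)⁻¹ * Ψ y| ≤ 1 := by
      rw [abs_mul, abs_of_pos (inv_pos.2 hpos), inv_mul_le_iff₀ hpos, mul_one]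
      exact hbd y
    rw [h2]
    calc |(Ψ y - Φ y) - (δ / 2) * ((1 + δ / 2)⁻¹ * Ψ y)|
        ≤ |Ψ y - Φ y| + |(δ / 2) * ((1 + δ / 2)⁻¹ * Ψ y)| := abs_sub _ _
      _ ≤ δ / 2 + δ / 2 * 1 := by
          rw [abs_mul (δ / 2), abs_of_pos (half_pos hδ)]
          gcongr
          exact hnear y
      _ = δ := by ring

/-- Functions with a given Lipschitz constant and values in `[-1, 1]` admit finite nets. -/
theorem exists_finite_net_isBoundedLipschitz [CompactSpace X] (M : ℝ) {δ : ℝ} (hδ : 0 < δ) :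
    ∃ t : Set C(X, ℝ), t.Finite ∧ (∀ F ∈ t, ∀ x, F x ∈ Set.Icc (-1 : ℝ) 1) ∧
      ∀ F : X → ℝ, IsBoundedLipschitz edist M F → ∃ F' ∈ t, ∀ x, |F x - F' x| ≤ δ := by
  set A : Set (BoundedContinuousFunction X ℝ) := {F | IsBoundedLipschitz edist M F} with hA
  have hcomp : IsCompact (closure A) := by
    refine BoundedContinuousFunction.arzela_ascoli (Set.Icc (-1) 1) isCompact_Icc A
      (fun F x hF => hF.mem_Icc x) fun x U hU => ?_
    obtain ⟨η, hη, hηU⟩ := Metric.mem_uniformity_dist.1 hU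
    have hM : ∀ᶠ y in nhds x, ENNReal.ofReal M * edist x y < ENNReal.ofReal η := by
      have : Filter.Tendsto (fun y => ENNReal.ofReal M * edist x y) (nhds x) (nhds 0) := by
        have h1 : Filter.Tendsto (fun y => edist x y) (nhds x) (nhds 0) := by
          simpa using (Continuous.edist continuous_const continuous_id).tendsto (f := fun y => edist x y) x
        simpa using ENNReal.Tendsto.const_mul h1 (Or.inr ENNReal.ofReal_ne_top)
      exact this.eventually (gt_mem_nhds (ENNReal.ofReal_pos.2 hη))
    filter_upwards [hM] with y hy F
    refine hηU ?_
    have := (F.2.lipschitz x y).trans_lt hy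
    rw [ENNReal.ofReal_lt_ofReal_iff hη] at this
    rwa [Real.dist_eq]
  obtain ⟨t, htA, htfin, ht⟩ := Metric.finite_approx_of_totallyBounded
    (hcomp.totallyBounded.subset subset_closure) δ hδ
  refine ⟨BoundedContinuousFunction.toContinuousMap '' t, htfin.image _, ?_, fun F hF => ?_⟩
  · rintro _ ⟨F, hF, rfl⟩ x
    exact (htA hF).mem_Icc x
  · obtain ⟨F', hF', hd⟩ := Set.mem_iUnion₂.1
      (ht (show BoundedContinuousFunction.mkOfCompact ⟨F, hF.continuous⟩ ∈ A from hF))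
    exact ⟨_, ⟨F', hF', rfl⟩, fun x =>
      (BoundedContinuousFunction.dist_coe_le_dist x).trans (Metric.mem_ball.1 hd).le⟩

end LipschitzFunctions

/-! ### Dual norm bounds for averages over parallelepipeds. -/

section DualBound

/-- Averages of `Ψ` over the vertices other than the last one of parallelepipeds have bounded dual
norm, uniformly over sequences of points. -/
def HasDualBound {X : Type*} {k m : ℕ} (τ : Fin m → Fin (k + 2) → Bool) (Ψ : (Fin m → X) → ℝ) :
    Prop :=
  ∃ D : ℝ, 0 ≤ D ∧ ∀ N : ℕ, 1 ≤ N → ∀ f : ℤ → ℂ, gowersNorm (k + 2) N f ≤ 1 → ∀ p : ℕ → X,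
    ‖∑ n ∈ Finset.Icc 1 N, f (n : ℤ) * ∑ u : Fin (k + 2) → Fin N, ∑ u' : Fin (k + 2) → Fin N,
      (Ψ fun i => p (n + ∑ j, if τ i j then 0 else (u j : ℕ) + u' j) : ℂ)‖ ≤
      D * (N : ℝ) ^ (2 * k + 5)

variable {X : Type*} {k m : ℕ} {τ : Fin m → Fin (k + 2) → Bool} {Ψ Ψ' : (Fin m → X) → ℝ}

theorem HasDualBound.zero : HasDualBound τ (fun _ : Fin m → X => 0) :=
  ⟨0, le_rfl, fun N _ f _ p => by simp⟩

theorem HasDualBound.add (h : HasDualBound τ Ψ) (h' : HasDualBound τ Ψ') :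
    HasDualBound τ fun y => Ψ y + Ψ' y := by
  obtain ⟨D, hD, h⟩ := h
  obtain ⟨D', hD', h'⟩ := h'
  refine ⟨D + D', add_nonneg hD hD', fun N hN f hf p => ?_⟩
  simp only [Complex.ofReal_add, Finset.sum_add_distrib, mul_add, add_mul]
  exact (norm_add_le _ _).trans (add_le_add (h N hN f hf p) (h' N hN f hf p))

theorem HasDualBound.const_mul (c : ℝ) (h : HasDualBound τ Ψ) :
    HasDualBound τ fun y => c * Ψ y := by
  obtain ⟨D, hD, h⟩ := h
  refine ⟨|c| * D, by positivity, fun N hN f hf p => ?_⟩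
  simp only [Complex.ofReal_mul, ← Finset.mul_sum, mul_left_comm _ (c : ℂ)]
  rw [norm_mul, Complex.norm_real, Real.norm_eq_abs, mul_assoc]
  exact mul_le_mul_of_nonneg_left (h N hN f hf p) (abs_nonneg _)

theorem IsBoundedProduct.hasDualBound (h : IsBoundedProduct Ψ)
    (τ : Fin m ≃ {v : Fin (k + 2) → Bool // v ≠ fun _ => true}) :
    HasDualBound (fun i => (τ i : Fin (k + 2) → Bool)) Ψ := by
  obtain ⟨φ, hφ, hΨ⟩ := h
  refine ⟨(2 * k + 7 : ℝ) ^ (k + 3), by positivity, fun N hN f hf p => ?_⟩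
  -- Complementing `v` exchanges the omitted last vertex with the base vertex carrying `f`; the
  -- default value `0` occurs only at that erased vertex.
  set b : (Fin (k + 2) → Bool) → ℕ → ℂ := fun v n =>
    if h : (fun j => !(v j)) ≠ fun _ => true then (φ (τ.symm ⟨fun j => !(v j), h⟩) (p n) : ℂ) else 0
    with hb
  have hb1 (v n) : ‖b v n‖ ≤ 1 := by
    simp only [hb]
    split_ifs
    · rw [Complex.norm_real]
      exact hφ _ _
    · simp
  refine le_trans (le_of_eq ?_) (norm_sum_dual_le hN b hb1 f hf)
  congr 1
  refine Finset.sum_congr rfl fun n _ => ?_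
  congr 1
  refine Finset.sum_congr rfl fun u _ => Finset.sum_congr rfl fun u' _ => ?_
  rw [hΨ, Complex.ofReal_prod]
  refine Finset.prod_bij (fun i _ j => !((τ i : Fin (k + 2) → Bool) j)) ?_ ?_ ?_ ?_
  · intro i _
    refine Finset.mem_erase.2 ⟨fun h => (τ i).2 ?_, Finset.mem_univ _⟩
    ext j
    simpa using congr_fun h j
  · intro i _ i' _ h
    refine τ.injective (Subtype.ext ?_)
    ext j
    simpa using congr_fun h j
  · intro v hv
    have hv' : (fun j => !(v j)) ≠ fun _ => true := fun h => Finset.ne_of_mem_erase hv (by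
      ext j
      simpa using congr_fun h j)
    exact ⟨τ.symm ⟨_, hv'⟩, Finset.mem_univ _, by simp⟩
  · intro i _
    have h1 : (fun j => !!((τ i : Fin (k + 2) → Bool) j)) = (τ i : Fin (k + 2) → Bool) := by simp
    have h2 : (fun j => !!((τ i : Fin (k + 2) → Bool) j)) ≠ fun _ => true := by
      rw [h1]; exact (τ i).2
    have h3 : τ.symm ⟨_, h2⟩ = i := by
      rw [Equiv.symm_apply_eq]
      exact Subtype.ext h1
    simp only [hb]
    rw [dif_pos h2, h3]
    congr 4
    refine Finset.sum_congr rfl fun j _ => ?_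
    by_cases h : (τ i : Fin (k + 2) → Bool) j <;> simp [h]

/-- Both properties are stable under linear combinations, with constants depending on `Ψ` but not on
`N`, `f` or the points. -/
theorem of_mem_span_coordFun {X : Type*} [EMetricSpace X] [CompactSpace X]
    (τ : Fin m ≃ {v : Fin (k + 2) → Bool // v ≠ fun _ => true}) {Ψ : C(Fin m → X, ℝ)}
    (h : Ψ ∈ Submodule.span ℝ
        (Submonoid.closure {Ψ : C(Fin m → X, ℝ) | ∃ i a, Ψ = coordFun i a} : Set C(Fin m → X, ℝ))) :
    HasLipschitzBound (productEDist m edist) Ψ ∧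
      HasDualBound (fun i => (τ i : Fin (k + 2) → Bool)) Ψ := by
  induction h using Submodule.span_induction with
  | mem Ψ h =>
    obtain ⟨h1, h2⟩ := of_mem_closure_coordFun h
    exact ⟨h1, h2.hasDualBound τ⟩
  | zero => exact ⟨HasLipschitzBound.const 0, HasDualBound.zero⟩
  | add Ψ Ψ' _ _ h h' => exact ⟨h.1.add h'.1, h.2.add h'.2⟩
  | smul c Ψ _ h => exact ⟨h.1.const_mul c, h.2.const_mul c⟩

theorem gowersDualNorm_le {k N : ℕ} {F : ℕ → ℝ} {D : ℝ}
    (h : ∀ f : ℤ → ℂ, gowersNorm k N f ≤ 1 →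
      ‖(∑ n ∈ Finset.Icc 1 N, f (n : ℤ) * (F n : ℂ)) / (N : ℂ)‖ ≤ D) :
    gowersDualNorm k N F ≤ ENNReal.ofReal D := by
  refine iSup₂_le fun f hf => ?_
  rw [← ofReal_norm]
  exact ENNReal.ofReal_le_ofReal (h f hf)

end DualBound

/-! ### Construction of the decomposition. -/

section Decomposition

variable {G : Type*} [Group G] {X : Type*} [EMetricSpace X] [CompactSpace X] [MulAction G X]

theorem IsBoundedLipschitz.mono {Y : Type*} [TopologicalSpace Y] {d : Y → Y → ℝ≥0∞} {L L' : ℝ}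
    {F : Y → ℝ} (h : IsBoundedLipschitz d L F) (hL : L ≤ L') : IsBoundedLipschitz d L' F :=
  ⟨h.continuous, h.mem_Icc, fun x y => (h.lipschitz x y).trans
    (mul_le_mul_left (ENNReal.ofReal_le_ofReal hL) _)⟩

theorem card_cube_punctured (k : ℕ) (v₀ : Fin k → Bool) :
    Fintype.card {v : Fin k → Bool // v ≠ v₀} = 2 ^ k - 1 := by
  simp [Fintype.card_subtype_compl]

/-- The decomposition of nilsequences for a system whose parallelepipeds lie in a compact set of
cubes whose last vertex is determined by the others. -/
theorem exists_decomposition {k : ℕ} {P : Set ((Fin (k + 2) → Bool) → X)} (hP : IsCompact P)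
    (hcube : ∀ (g : G) (x : X) (m : ℤ) (h : Fin (k + 2) → ℤ),
      (fun v => g ^ (m + ∑ j, if v j then h j else 0) • x) ∈ P)
    (hdet : ∀ p ∈ P, ∀ q ∈ P, (∀ v, v ≠ (fun _ => true) → p v = q v) →
      p (fun _ => true) = q (fun _ => true))
    (M : ℝ) {ε : ℝ} (hε : 0 < ε) :
    ∃ L D : ℝ, 0 < L ∧ 0 < D ∧ ∀ (F : X → ℝ) (g : G) (x : X) (N : ℕ),
      IsBoundedLipschitz edist M F → 1 ≤ N →
      ∃ F₁ F₂ : ℕ → ℝ, (∀ n : ℕ, F (g ^ n • x) = F₁ n + F₂ n) ∧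
        (∀ n : ℕ, F₁ n ∈ Set.Icc (-1 : ℝ) 1) ∧
        IsAveragedNilsequence (Fin (2 ^ (k + 2) - 1) → G)
          (productEDist (2 ^ (k + 2) - 1) (edist : X → X → ℝ≥0∞)) L F₁ ∧
        gowersDualNorm (k + 2) N F₁ ≤ ENNReal.ofReal D ∧ (∀ n : ℕ, |F₂ n| ≤ ε) := by
  set m := 2 ^ (k + 2) - 1 with hm
  have τ : Fin m ≃ {v : Fin (k + 2) → Bool // v ≠ fun _ => true} :=
    (Fintype.equivFinOfCardEq (card_cube_punctured _ _)).symm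
  -- Half of `ε` pays for replacing `F` by a net element, half for approximating that element by
  -- `Ψ`. Finiteness of the net makes `L` and `D` uniform in `F`.
  obtain ⟨t, htfin, ht, hnet⟩ := exists_finite_net_isBoundedLipschitz (X := X) M (half_pos hε)
  have happrox (F : t) := exists_approx_of_isCompact_cubes τ hP hdet F.1 (ht F.1 F.2) (half_pos hε)
  choose Ψ hΨs hΨ1 hΨP using happrox
  choose L hL hLip using fun F => (of_mem_span_coordFun τ (hΨs F)).1
  choose D hD hdual using fun F => (of_mem_span_coordFun τ (hΨs F)).2
  have := htfin.to_subtype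
  obtain ⟨L₀, hL₀⟩ := (Set.finite_range L).bddAbove
  obtain ⟨D₀, hD₀⟩ := (Set.finite_range D).bddAbove
  refine ⟨|L₀| + 1, |D₀| + 1, by positivity, by positivity, fun F g x N hF hN => ?_⟩
  obtain ⟨F', hF', hFF'⟩ := hnet F hF
  set Φ := Ψ ⟨F', hF'⟩ with hΦ
  set ι := (Fin (k + 2) → Fin N) × (Fin (k + 2) → Fin N) with hι
  have hN0 : NeZero N := ⟨by omega⟩
  have hcard : (0 : ℝ) < Fintype.card ι := Nat.cast_pos.2 Fintype.card_pos
  set pt : ℕ → ι → Fin m → X := fun n u i =>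
    g ^ (n + ∑ j, if (τ i : Fin (k + 2) → Bool) j then 0 else (u.1 j : ℕ) + u.2 j) • x with hpt
  set F₁ : ℕ → ℝ := fun n => (∑ u, Φ (pt n u)) / Fintype.card ι with hF₁
  -- The cube is read backwards: it starts at `n + ∑ j, (u.1 j + u.2 j)` with negative edges, so its
  -- last vertex is `n` and the others have natural exponents.
  have happ (n : ℕ) (u : ι) : |Φ (pt n u) - F (g ^ n • x)| ≤ ε := by
    have h1 := hΨP ⟨F', hF'⟩ _ (hcube g x (n + ∑ j, ((u.1 j : ℤ) + u.2 j))
      fun j => -((u.1 j : ℤ) + u.2 j))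
    have e1 : (g ^ ((n : ℤ) + ∑ j, ((u.1 j : ℤ) + u.2 j) +
        ∑ j, if (fun _ => true : Fin (k + 2) → Bool) j then -((u.1 j : ℤ) + u.2 j) else 0)) = g ^ n := by
      simp only [if_true, Finset.sum_neg_distrib, add_neg_cancel_right, zpow_natCast]
    have e2 : (fun i => g ^ ((n : ℤ) + ∑ j, ((u.1 j : ℤ) + u.2 j) +
        ∑ j, if (τ i : Fin (k + 2) → Bool) j then -((u.1 j : ℤ) + u.2 j) else 0) • x) = pt n u := by
      ext i
      simp only [hpt]
      rw [add_assoc, ← Finset.sum_add_distrib, ← zpow_natCast]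
      congr 2
      push_cast
      congr 1
      refine Finset.sum_congr rfl fun j _ => ?_
      split_ifs <;> simp
    rw [e1, e2] at h1
    calc |Φ (pt n u) - F (g ^ n • x)|
        = |(Φ (pt n u) - F' (g ^ n • x)) - (F (g ^ n • x) - F' (g ^ n • x))| := by congr 1; ring
      _ ≤ ε / 2 + ε / 2 := (abs_sub _ _).trans (add_le_add h1 (hFF' _))
      _ = ε := add_halves ε
  have havg (n : ℕ) {c r : ℝ} (h : ∀ u, |Φ (pt n u) - c| ≤ r) : |F₁ n - c| ≤ r := by
    have : F₁ n - c = (∑ u, (Φ (pt n u) - c)) / Fintype.card ι := by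
      rw [hF₁, Finset.sum_sub_distrib]
      simp only [Finset.sum_const, Finset.card_univ, nsmul_eq_mul]
      field_simp
    rw [this, abs_div, abs_of_pos hcard, div_le_iff₀ hcard]
    refine (Finset.abs_sum_le_sum_abs _ _).trans ((Finset.sum_le_sum fun u _ => h u).trans_eq ?_)
    simp [mul_comm]
  refine ⟨F₁, fun n => F (g ^ n • x) - F₁ n, fun n => by ring, fun n => ?_, ?_, ?_, fun n => ?_⟩
  · have := havg n (c := 0) (r := 1) fun u => by
      rw [sub_zero]
      exact abs_le.2 (hΨ1 _ _)
    rw [sub_zero] at this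
    exact abs_le.1 this
  -- For fixed edges, `pt n u` is the orbit of `pt 0 u` under the diagonal element `(g, …, g)`.
  · refine ⟨Fintype.card ι, Fintype.card_pos, fun _ => Φ, fun _ _ => g,
      fun a => pt 0 ((Fintype.equivFin ι).symm a), fun _ => ?_, fun n => ?_⟩
    · refine IsBoundedLipschitz.mono (L := L ⟨F', hF'⟩) ⟨Φ.continuous, hΨ1 _, hLip _⟩ ?_
      have := hL₀ ⟨⟨F', hF'⟩, rfl⟩
      linarith [le_abs_self L₀]
    · rw [hF₁]
      dsimp only
      rw [← (Fintype.equivFin ι).symm.sum_comp]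
      congr 1
      refine Finset.sum_congr rfl fun a _ => ?_
      congr 1
      ext i
      simp only [hpt, Pi.smul_apply', Pi.pow_apply, smul_smul, ← pow_add, zero_add]
  · refine gowersDualNorm_le fun f hf => ?_
    have h1 := hdual ⟨F', hF'⟩ N hN f hf fun n => g ^ n • x
    have h2 : (∑ n ∈ Finset.Icc 1 N, f (n : ℤ) * (F₁ n : ℂ)) = (∑ n ∈ Finset.Icc 1 N, f (n : ℤ) *
        ∑ u : Fin (k + 2) → Fin N, ∑ u' : Fin (k + 2) → Fin N, (Φ (pt n (u, u')) : ℂ)) /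
          Fintype.card ι := by
      rw [Finset.sum_div]
      refine Finset.sum_congr rfl fun n _ => ?_
      rw [mul_div_assoc, ← Fintype.sum_prod_type', hF₁]
      push_cast
      rfl
    have hNpos : (0 : ℝ) < N := by exact_mod_cast hN
    have hcardN : (Fintype.card ι : ℝ) = (N : ℝ) ^ (2 * k + 4) := by
      simp only [hι, Fintype.card_prod, Fintype.card_fun, Fintype.card_fin]
      push_cast
      ring
    rw [h2, norm_div, norm_div, Complex.norm_natCast, Complex.norm_natCast, hcardN,
      div_div, ← pow_succ, div_le_iff₀ (by positivity)]
    refine h1.trans (mul_le_mul_of_nonneg_right ?_ (by positivity))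
    have := hD₀ ⟨⟨F', hF'⟩, rfl⟩
    linarith [le_abs_self D₀]
  · rw [abs_sub_comm]
    exact havg n fun u => happ n u

end Decomposition

/-- The decomposition is trivial when the space is reduced to a point. -/
theorem exists_decomposition_of_subsingleton {G : Type*} [Group G] {X : Type*} [EMetricSpace X]
    [MulAction G X] [Subsingleton X] (M ε : ℝ) (hε : 0 < ε) :
    ∃ L D : ℝ, 0 < L ∧ 0 < D ∧ ∀ (F : X → ℝ) (g : G) (x : X) (N : ℕ),
      IsBoundedLipschitz edist M F → 1 ≤ N →
      ∃ F₁ F₂ : ℕ → ℝ, (∀ n : ℕ, F (g ^ n • x) = F₁ n + F₂ n) ∧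
        (∀ n : ℕ, F₁ n ∈ Set.Icc (-1 : ℝ) 1) ∧
        IsAveragedNilsequence (Fin (2 ^ (0 + 1) - 1) → G)
          (productEDist (2 ^ (0 + 1) - 1) (edist : X → X → ℝ≥0∞)) L F₁ ∧
        gowersDualNorm (0 + 1) N F₁ ≤ ENNReal.ofReal D ∧ (∀ n : ℕ, |F₂ n| ≤ ε) := by
  refine ⟨1, 5, one_pos, by norm_num, fun F g x N hF hN => ⟨fun _ => F x, 0, fun n => ?_,
    fun _ => hF.mem_Icc x, ?_, ?_, fun n => by simpa using hε.le⟩⟩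
  · rw [Subsingleton.elim (g ^ n • x) x]
    simp
  · refine ⟨1, one_pos, fun _ _ => F x, fun _ => 1, fun _ _ => x, fun _ => ⟨continuous_const,
      fun _ => hF.mem_Icc x, by simp⟩, by simp⟩
  · refine gowersDualNorm_le fun f hf => ?_
    have hNpos : (0 : ℝ) < N := by exact_mod_cast hN
    rw [← Finset.sum_mul, norm_div, norm_mul, Complex.norm_natCast, Complex.norm_real,
      div_le_iff₀ hNpos]
    calc _ ≤ ‖∑ n ∈ Finset.Icc 1 N, f (n : ℤ)‖ * 1 :=
          mul_le_mul_of_nonneg_left (abs_le.2 (hF.mem_Icc x)) (norm_nonneg _)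
      _ ≤ 5 * N := by
          rw [mul_one]
          exact norm_sum_Icc_le_of_gowersNorm_one hN f hf

/-! ### Application to Riemannian nilmanifolds. -/

theorem t2Space_quotient_of_isClosed {G : Type*} [Group G] [TopologicalSpace G]
    [IsTopologicalGroup G] (Γ : Subgroup G) (hΓ : IsClosed (Γ : Set G)) : T2Space (G ⧸ Γ) := by
  rw [t2Space_iff_of_isOpenQuotientMap (QuotientGroup.isOpenQuotientMap_mk (N := Γ))]
  have : {q : G × G | (QuotientGroup.mk q.1 : G ⧸ Γ) = QuotientGroup.mk q.2} =
      (fun q : G × G => q.1⁻¹ * q.2) ⁻¹' (Γ : Set G) := by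
    ext q
    exact QuotientGroup.eq
  rw [this]
  exact hΓ.preimage (by fun_prop)

theorem mainTheorem9 (s : ℕ)
    -- a connected, simply connected Lie group `G`
    {E : Type*} [NormedAddCommGroup E] [NormedSpace ℝ E] [FiniteDimensional ℝ E]
    {G : Type*} [Group G] [TopologicalSpace G] [T2Space G] [ChartedSpace E G]
    [LieGroup 𝓘(ℝ, E) ∞ G] [ConnectedSpace G] [SimplyConnectedSpace G]
    -- `s`-step nilpotent: the term `G_{s+1}` of the lower central series (`G_1 = G`) is trivial
    (hs : Subgroup.lowerCentralSeries (⊤ : Subgroup G) s = ⊥)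
    -- a discrete cocompact subgroup
    (Γ : Subgroup G) [DiscreteTopology Γ] [CompactSpace (G ⧸ Γ)]
    -- the quotient smooth structure on `G ⧸ Γ`: the one making `G → G ⧸ Γ` a local diffeomorphism
    [ChartedSpace E (G ⧸ Γ)] [IsManifold 𝓘(ℝ, E) ∞ (G ⧸ Γ)]
    (hΓ : IsLocalDiffeomorph 𝓘(ℝ, E) 𝓘(ℝ, E) ∞ (QuotientGroup.mk : G → G ⧸ Γ))
    -- a smooth Riemannian metric on `G ⧸ Γ`
    [Bundle.RiemannianBundle fun x : G ⧸ Γ => TangentSpace 𝓘(ℝ, E) x]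
    [IsContMDiffRiemannianBundle 𝓘(ℝ, E) ∞ E fun x : G ⧸ Γ => TangentSpace 𝓘(ℝ, E) x]
    (M : ℝ) (hM : 0 < M) (ε : ℝ) (hε : ε ∈ Set.Ioo (0 : ℝ) 1) :
    ∃ L D : ℝ, 0 < L ∧ 0 < D ∧
      ∀ (F : G ⧸ Γ → ℝ) (g : G) (x : G ⧸ Γ) (N : ℕ),
        IsBoundedLipschitz (Manifold.riemannianEDist 𝓘(ℝ, E)) M F → 1 ≤ N →
        ∃ F₁ F₂ : ℕ → ℝ,
          (∀ n : ℕ, F (g ^ n • x) = F₁ n + F₂ n) ∧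
          (∀ n : ℕ, F₁ n ∈ Set.Icc (-1 : ℝ) 1) ∧
          IsAveragedNilsequence (Fin (2 ^ (s + 1) - 1) → G)
            (productEDist (2 ^ (s + 1) - 1)
              (Manifold.riemannianEDist 𝓘(ℝ, E) : G ⧸ Γ → G ⧸ Γ → ℝ≥0∞)) L F₁ ∧
          gowersDualNorm (s + 1) N F₁ ≤ ENNReal.ofReal D ∧
          (∀ n : ℕ, |F₂ n| ≤ ε) := by
  have : IsTopologicalGroup G := topologicalGroup_of_lieGroup 𝓘(ℝ, E) ∞
  have : LocallyCompactSpace G := ChartedSpace.locallyCompactSpace E G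
  have : CompleteSpace E := FiniteDimensional.complete ℝ E
  have hroots := closure_hasVanishingRoots (eventually_hasVanishingRoots (E := E) (G := G))
  have : T2Space (G ⧸ Γ) := t2Space_quotient_of_isClosed Γ Subgroup.isClosed_of_discrete
  have : IsManifold 𝓘(ℝ, E) 1 (G ⧸ Γ) := IsManifold.of_le (n := ∞) (by simp)
  have : IsContinuousRiemannianBundle E fun x : G ⧸ Γ => TangentSpace 𝓘(ℝ, E) x := by
    obtain ⟨b, hb, h⟩ := IsContMDiffRiemannianBundle.exists_contMDiff (IB := 𝓘(ℝ, E)) (n := ∞)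
      (F := E) (E := fun x : G ⧸ Γ => TangentSpace 𝓘(ℝ, E) x)
    exact ⟨b, hb.continuous, h⟩
  -- With this instance `edist` unfolds to the Riemannian distance of the statement.
  let : EMetricSpace (G ⧸ Γ) := EMetricSpace.ofRiemannianMetric 𝓘(ℝ, E) (G ⧸ Γ)
  -- For `s = 0` the hypothesis makes `G` trivial; from `s = 1` on the Gowers norm has degree at
  -- least `2`, as modulation invariance requires.
  cases s with
  | zero =>
    have : Subsingleton G := by
      rw [Subgroup.lowerCentralSeries_zero] at hs
      exact Subgroup.subsingleton_iff.1 (subsingleton_of_top_eq_bot hs)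
    have : Subsingleton (G ⧸ Γ) := QuotientGroup.mk_surjective.subsingleton
    exact exists_decomposition_of_subsingleton (X := G ⧸ Γ) (G := G) M ε hε.1
  | succ s =>
    obtain ⟨P, hP, hcube, hdet⟩ := exists_isCompact_cubes hroots Γ hs
    exact exists_decomposition (X := G ⧸ Γ) (G := G) hP hcube hdet M hε.1
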